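/- Let $Q$ be a smooth 2-manifold, let $H(\alpha)=\tfrac12\langle\alpha,\rho^\sharp(\alpha)\rangle+h(\pi(\alpha))$ be a simple Hamiltonian on $T^*Q$, where $\pi:T^*Q\to Q$ is the projection, $\rho$ is a smooth Riemannian metric on $Q$ and $h\in C^\infty(Q)$, and let $X_H$ be its Hamiltonian vector field with respect to the canonical symplectic form. Let $\xi$ be a nowhere vanishing smooth one-form on $Q$, let $W_q=\operatorname{span}\{\xi(q)\}\subset T_q^*Q$, and let $\mathcal W_\alpha=\operatorname{span}\{\operatorname{vlift}_\alpha(\xi(\pi(\alpha)))\}\subset T_\alpha T^*Q$, where $\operatorname{vlift}_\alpha(\beta)=\frac{d}{dt}\big|_{t=0}(\alpha+t\beta)$, be the corresponding rank-one vertical subbundle (one actuator). Let $\alpha_0=(q_0,0)\in T^*Q$ be a critical point of $X_H$. Fix a chart $\varphi=(x,y)$ of $Q$ centred at $q_0$ and adapted to $W$, i.e. $\varphi(q_0)=(0,0)$ and $W$ is spanned by $dy$ on the domain of $\varphi$, and write in the induced coordinates $$H(x,y,p_x,p_y)=\tfrac12\left(a\,p_x^2+2b\,p_xp_y+c\,p_y^2\right)+h(x,y),$$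 with $a,b,c$ and $h$ functions of $(x,y)$. Suppose that $$\left[b\,h_{xx}+c\,h_{xy}\right](0,0)\neq0\quad\text{or}\quad h_{xx}(0,0)>0 .$$ Then $(H,\mathcal W)$ is stabilizable at $\alpha_0$ by means of a simple Lyapunov function. That is, there exist an open neighbourhood $U$ of $q_0$ in $Q$ and a smooth vector field $Y$ on $T^*U=\pi^{-1}(U)$ with $Y(\alpha)\in\mathcal W_\alpha$ for all $\alpha\in T^*U$, such that $\alpha_0$ is a critical point of $X_H+Y$ and is (Lyapunov) stable for $X_H+Y$; moreover there are a smooth Riemannian metric $g$ on $U$ and $v\in C^\infty(U)$ such that the simple function $V(\alpha)=\tfrac12\langle\alpha,g^\sharp(\alpha)\rangle+v(\pi(\alpha))$ is a Lyapunov function for $X_H+Y$ and $\alpha_0$ on $T^*U$: $V(\alpha_0)=0$, $V(\alpha)>0$ for all $\alpha\in T^*U\setminus\{\alpha_0\}$, and $\langle dV(\alpha),(X_H+Y)(\alpha)\rangle\le0$ for all $\alpha\in T^*U$. -/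

import Mathlib

open Set Filter Topology Bundle
open scoped Manifold ContDiff

noncomputable section

namespace LCB

/-- The model space `ℝ²`. -/
abbrev E2 : Type := EuclideanSpace ℝ (Fin 2)

/-- The model space `(ℝ²)*` of the covectors. -/
abbrev E2Dual : Type := E2 →L[ℝ] ℝ

/-- The model with corners of the cotangent bundle of a 2-manifold. -/
abbrev cotModel : ModelWithCorners ℝ (E2 × E2Dual) (ModelProd E2 E2Dual) :=
  (𝓡 2).prod 𝓘(ℝ, E2Dual)

section Dynamics

variable {F : Type*} [NormedAddCommGroup F] [NormedSpace ℝ F] {K : Type*} [TopologicalSpace K]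
  (J : ModelWithCorners ℝ F K) {P : Type*} [TopologicalSpace P] [ChartedSpace K P]

/-- `α₀` is a (Lyapunov) stable critical point of the vector field `X` given on the open set `D`:
`X α₀ = 0`, and for every neighbourhood `N` of `α₀` there is a neighbourhood `N'` of `α₀` such
that from every point of `N'` there starts a trajectory defined for all `t ≥ 0`, and every
trajectory that starts in `N'` remains in `N` for as long as it is defined. -/
def IsStableAt (X : ∀ α : P, TangentSpace J α) (D : Set P) (α₀ : P) : Prop :=
  α₀ ∈ D ∧ X α₀ = 0 ∧
  ∀ N ∈ 𝓝 α₀, ∃ N' ∈ 𝓝 α₀, ∀ α ∈ N',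
    (∃ Γ : ℝ → P, Γ 0 = α ∧ (∀ t ∈ Ici (0 : ℝ), Γ t ∈ D) ∧
      IsMIntegralCurveOn (I := J) Γ X (Ici 0)) ∧
    (∀ (Γ : ℝ → P) (τ : ℝ), Γ 0 = α → (∀ t ∈ Ico 0 τ, Γ t ∈ D) →
      IsMIntegralCurveOn (I := J) Γ X (Ico 0 τ) → ∀ t ∈ Ico 0 τ, Γ t ∈ N)

/-- The derivative `⟨dV(α), X(α)⟩` of `V` along the vector field `X` at `α`. -/
def derivAlong (V : P → ℝ) (X : ∀ α : P, TangentSpace J α) (α : P) : ℝ :=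
  mfderiv J 𝓘(ℝ, ℝ) V α (X α)

/-- `V` is a Lyapunov function for the vector field `X`, given on the open set `D`, and its
critical point `α₀`. -/
structure IsLyapunovOn (X : ∀ α : P, TangentSpace J α) (V : P → ℝ) (D : Set P) (α₀ : P) :
    Prop where
  mem : α₀ ∈ D
  critical : X α₀ = 0
  smooth : ContMDiffOn J 𝓘(ℝ, ℝ) ∞ V D
  zero : V α₀ = 0
  pos : ∀ α ∈ D, α ≠ α₀ → 0 < V α
  decreasing : ∀ α ∈ D, derivAlong J V X α ≤ 0

end Dynamics

section Cotangent

variable {Q : Type*} [TopologicalSpace Q] [ChartedSpace E2 Q]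

/-- The cotangent bundle `T*Q`. It carries Mathlib's topology and smooth structure of the bundle
of continuous linear maps from the tangent bundle to the trivial line bundle. -/
abbrev CotangentBundle (Q : Type*) [TopologicalSpace Q] [ChartedSpace E2 Q] : Type _ :=
  TotalSpace E2Dual (fun q : Q => TangentSpace (𝓡 2) q →L[ℝ] ℝ)

/-- The point `(q, 0)` of the null section of `T*Q`. -/
def nullPoint (q : Q) : CotangentBundle Q := ⟨q, 0⟩

/-- The part `T*U = π⁻¹(U)` of the cotangent bundle. -/
def cotangentOver (U : Set Q) : Set (CotangentBundle Q) := {α | α.proj ∈ U}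

/-- The differential `T_q Q → ℝ²` at `q` of a chart `φ`. -/
def chartDeriv (φ : OpenPartialHomeomorph Q E2) (q : Q) : TangentSpace (𝓡 2) q →L[ℝ] E2 :=
  mfderiv (𝓡 2) 𝓘(ℝ, E2) φ q

/-- The coordinate vector `∂/∂qⁱ` at `q` of a chart `φ`. -/
def coordVec (φ : OpenPartialHomeomorph Q E2) (i : Fin 2) (q : Q) : TangentSpace (𝓡 2) q :=
  (chartDeriv φ q).inverse (EuclideanSpace.single i (1 : ℝ))

/-- The coordinate differential `dqⁱ` at `q` of a chart `φ`. -/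
def coordDiff (φ : OpenPartialHomeomorph Q E2) (i : Fin 2) (q : Q) :
    TangentSpace (𝓡 2) q →L[ℝ] ℝ :=
  mfderiv (𝓡 2) 𝓘(ℝ, ℝ) (fun q' : Q => φ q' i) q

/-- The coordinates `(q, p)` on `T*Q` induced by a chart `φ` of `Q`: `q` are the coordinates of
the base point, and the momentum `p` is the covector transported to `ℝ²` by `φ`. -/
def cotangentCoord (φ : OpenPartialHomeomorph Q E2) (α : CotangentBundle Q) : E2 × E2Dual :=
  (φ α.proj, α.snd.comp (chartDeriv φ α.proj).inverse)

/-- The symplectic form `dqⁱ ∧ dpᵢ` on `ℝ² × (ℝ²)*`: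
`((u₁, w₁), (u₂, w₂)) ↦ w₂(u₁) - w₁(u₂)`. -/
def stdSymplectic : (E2 × E2Dual) →L[ℝ] (E2 × E2Dual) →L[ℝ] ℝ :=
  (ContinuousLinearMap.apply ℝ ℝ : E2 →L[ℝ] E2Dual →L[ℝ] ℝ).bilinearComp
      (ContinuousLinearMap.fst ℝ E2 E2Dual) (ContinuousLinearMap.snd ℝ E2 E2Dual) -
    (ContinuousLinearMap.id ℝ E2Dual).bilinearComp
      (ContinuousLinearMap.snd ℝ E2 E2Dual) (ContinuousLinearMap.fst ℝ E2 E2Dual)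

/-- A simple (kinetic plus potential) function on `T*Q`:
`α ↦ ½⟨α, g♯(α)⟩ + v(π(α))`, where `g♯` is the inverse of the map `u ↦ g(u, ·)`. -/
def simpleFn (g : ∀ q : Q, TangentSpace (𝓡 2) q →L[ℝ] TangentSpace (𝓡 2) q →L[ℝ] ℝ)
    (v : Q → ℝ) (α : CotangentBundle Q) : ℝ :=
  1 / 2 * α.snd ((g α.proj).inverse α.snd) + v α.proj

/-- The matrix of the kinetic term at `q` in the chart `φ`: the inverse of the matrix
`ρ(∂/∂qⁱ, ∂/∂qʲ)`. -/
def kineticMatrix (g : ∀ q : Q, TangentSpace (𝓡 2) q →L[ℝ] TangentSpace (𝓡 2) q →L[ℝ] ℝ)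
    (φ : OpenPartialHomeomorph Q E2) (q : Q) : Matrix (Fin 2) (Fin 2) ℝ :=
  (Matrix.of fun i j => g q (coordVec φ i q) (coordVec φ j q))⁻¹

/-- Partial derivative with respect to the `i`-th coordinate of `ℝ²`. -/
def partialDeriv (i : Fin 2) (f : E2 → ℝ) (z : E2) : ℝ :=
  fderiv ℝ f z (EuclideanSpace.single i (1 : ℝ))

/-- The condition `[b h_xx + c h_xy](0) ≠ 0` or `h_xx(0) > 0` on the local expression
`½ (a p_x² + 2 b p_x p_y + c p_y²) + h(x, y)` of the simple function given by `g` and `h`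
in a chart `φ` centred at `q₀`. -/
def PositivityCondition
    (g : ∀ q : Q, TangentSpace (𝓡 2) q →L[ℝ] TangentSpace (𝓡 2) q →L[ℝ] ℝ) (h : Q → ℝ)
    (φ : OpenPartialHomeomorph Q E2) (q₀ : Q) : Prop :=
  let b : ℝ := kineticMatrix g φ q₀ 0 1
  let c : ℝ := kineticMatrix g φ q₀ 1 1
  let hloc : E2 → ℝ := fun z => h (φ.symm z)
  let hxx : ℝ := partialDeriv 0 (partialDeriv 0 hloc) 0
  let hxy : ℝ := partialDeriv 1 (partialDeriv 0 hloc) 0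
  b * hxx + c * hxy ≠ 0 ∨ 0 < hxx

variable [IsManifold (𝓡 2) ∞ Q]

/-- The canonical symplectic form of `T*Q` at `α`, which is `dqⁱ ∧ dpᵢ` in the coordinates
`(q, p)` induced by a chart of `Q` around the base point of `α` (any such chart gives the
same form; the preferred chart at the base point is used). -/
def canonicalSymplectic (α : CotangentBundle Q) :
    TangentSpace cotModel α →L[ℝ] TangentSpace cotModel α →L[ℝ] ℝ :=
  let dΦ : (E2 × E2Dual) →L[ℝ] (E2 × E2Dual) :=
    mfderiv cotModel 𝓘(ℝ, E2 × E2Dual) (cotangentCoord (chartAt E2 α.proj)) α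
  stdSymplectic.bilinearComp dΦ dΦ

/-- The Hamiltonian vector field `X_H`, defined by `ω(X_H, ·) = dH` for the canonical symplectic
form `ω` of `T*Q`. -/
def hamiltonianVF (H : CotangentBundle Q → ℝ) (α : CotangentBundle Q) :
    TangentSpace cotModel α :=
  (canonicalSymplectic α).inverse (mfderiv cotModel 𝓘(ℝ, ℝ) H α)

/-- The vertical lift at `α` of a covector `β` at the base point of `α`: the velocity at `t = 0`
of the curve `t ↦ α + t β`. -/
def vlift (α : CotangentBundle Q) (β : TangentSpace (𝓡 2) α.proj →L[ℝ] ℝ) :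
    TangentSpace cotModel α :=
  mfderiv 𝓘(ℝ, ℝ) cotModel
    (fun t : ℝ => (⟨α.proj, α.snd + t • β⟩ : CotangentBundle Q)) 0 (1 : ℝ)

/-- The fibre at `α` of the vertical subbundle of `T T*Q` generated by the one-form `ξ`. -/
def actuation (ξ : ∀ q : Q, TangentSpace (𝓡 2) q →L[ℝ] ℝ) (α : CotangentBundle Q) :
    Submodule ℝ (TangentSpace cotModel α) :=
  Submodule.span ℝ {vlift α (ξ α.proj)}

/-- `ξ` is a smooth differential one-form on `Q`. -/
def IsSmoothForm (ξ : ∀ q : Q, TangentSpace (𝓡 2) q →L[ℝ] ℝ) : Prop :=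
  ContMDiff (𝓡 2) cotModel ∞ (fun q : Q => (⟨q, ξ q⟩ : CotangentBundle Q))

/-- `Y` is smooth as a vector field on the open subset `D` of `T*Q`. -/
def IsSmoothVFOn (Y : ∀ α : CotangentBundle Q, TangentSpace cotModel α)
    (D : Set (CotangentBundle Q)) : Prop :=
  ContMDiffOn cotModel cotModel.tangent ∞
    (fun α => (⟨α, Y α⟩ : TangentBundle cotModel (CotangentBundle Q))) D

/-- `g` is a smooth Riemannian metric on the open subset `U` of `Q`. -/
structure IsRiemannianMetricOn
    (g : ∀ q : Q, TangentSpace (𝓡 2) q →L[ℝ] TangentSpace (𝓡 2) q →L[ℝ] ℝ) (U : Set Q) :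
    Prop where
  symm : ∀ q ∈ U, ∀ u w : TangentSpace (𝓡 2) q, g q u w = g q w u
  pos : ∀ q ∈ U, ∀ u : TangentSpace (𝓡 2) q, u ≠ 0 → 0 < g q u u
  smooth : ContMDiffOn (𝓡 2) ((𝓡 2).prod 𝓘(ℝ, E2 →L[ℝ] E2 →L[ℝ] ℝ)) ∞
    (fun q : Q => TotalSpace.mk' (E2 →L[ℝ] E2 →L[ℝ] ℝ) q (g q)) U

/-- The chart `φ` is adapted to the line subbundle of `T*Q` spanned by `ξ`: over the domain of
`φ` this subbundle is spanned by the differential of the second coordinate. -/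
def IsAdapted (ξ : ∀ q : Q, TangentSpace (𝓡 2) q →L[ℝ] ℝ)
    (φ : OpenPartialHomeomorph Q E2) : Prop :=
  ∀ q ∈ φ.source, Submodule.span ℝ {ξ q} = Submodule.span ℝ {coordDiff φ 1 q}

end Cotangent

end LCB

end

/-!
In an adapted chart let `A` be the kinetic operator of `H`, and look for the Lyapunov function in
the form `V = ½(p_x² / α + α (p_y - κ p_x)²) + v`. The actuator contributes `u ∂V/∂p_y` to the
derivative of `V` along the closed loop, and `∂V/∂p_y` vanishes exactly where `p_y = κ p_x`. If
`X_H V` vanishes there too, Hadamard's lemma divides it by `p_y - κ p_x`, and the quotient yields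
a smooth feedback `u` that makes `V` a constant of motion. The condition on `X_H V` splits into
transport equations for `α` and for `v` along the direction `A (dx + κ dy)`. Choosing `κ` such
that this direction is a fixed vector `d` up to a positive factor, both are solved by integration
along `d`, starting from a line transverse to `d`. If `h_x` increases along `d` at the origin,
then a quadratic initial value on that line makes `v` positive definite; the hypothesis on `h`
provides such a `d`.
-/

namespace LCB

section Calculus

variable {E G : Type*} [NormedAddCommGroup E] [NormedSpace ℝ E] [NormedAddCommGroup G]
  [NormedSpace ℝ G]

open MeasureTheory in
theorem contDiffOn_parametric_intervalIntegral {n : ℕ∞} {s : Set E} (hs : IsOpen s)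
    {F : E × ℝ → G} (hF : ContDiffOn ℝ n F (s ×ˢ univ)) {a b : ℝ} (hab : a ≤ b) :
    ContDiffOn ℝ n (fun x => ∫ r in a..b, F (x, r)) s := by
  let χ : ContDiffBump ((a + b) / 2 : ℝ) :=
    ⟨(b - a) / 2 + 1, (b - a) / 2 + 2, by linarith, by linarith⟩
  have hχ {t : ℝ} (ht : t ∈ Ioc a b) : χ t = 1 := by
    refine χ.one_of_mem_closedBall ?_
    change |t - (a + b) / 2| ≤ (b - a) / 2 + 1
    rw [abs_le]
    constructor <;> linarith [ht.1, ht.2]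
  -- The integral is the value at `0` of a convolution with Lebesgue measure on `(a, b]`; the cutoff
  -- provides the compact support which the differentiability of convolutions requires.
  let g (x : E) (t : ℝ) : G := χ (-t) • F (x, -t)
  have hg : ContDiffOn ℝ n ↿g (s ×ˢ univ) :=
    (χ.contDiff.comp contDiff_snd.neg).contDiffOn.smul
      (hF.comp (contDiff_fst.prodMk contDiff_snd.neg).contDiffOn fun z hz => ⟨hz.1, mem_univ _⟩)
  have hconv := contDiffOn_convolution_right_with_param (μ := volume.restrict (Ioc a b))
    (ContinuousLinearMap.lsmul ℝ ℝ) hs χ.hasCompactSupport.isCompact.neg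
    (fun x t _ ht => by simp only [g, image_eq_zero_of_notMem_tsupport ht, zero_smul])
    (locallyIntegrable_const 1) hg
  refine (hconv.comp (contDiff_prodMk_left (0 : ℝ)).contDiffOn
    fun x hx => ⟨hx, mem_univ _⟩).congr fun x _ => ?_
  rw [intervalIntegral.integral_of_le hab]
  refine setIntegral_congr_fun measurableSet_Ioc fun t ht => ?_
  simp [g, hχ ht]

theorem exists_contDiff_eventuallyEq [FiniteDimensional ℝ E] {n : ℕ∞} {s : Set E}
    {x₀ : E} (hs : s ∈ 𝓝 x₀) {F : E → G} (hF : ContDiffOn ℝ n F s) :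
    ∃ F' : E → G, ContDiff ℝ n F' ∧ HasCompactSupport F' ∧ F' =ᶠ[𝓝 x₀] F := by
  obtain ⟨δ, hδ, hball⟩ := Metric.nhds_basis_closedBall.mem_iff.1 (interior_mem_nhds.2 hs)
  let χ : ContDiffBump x₀ := ⟨δ / 2, δ, by positivity, by linarith⟩
  refine ⟨fun x => χ x • F x, contDiff_iff_contDiffAt.2 fun x => ?_,
    χ.hasCompactSupport.smul_right, ?_⟩
  · by_cases hx : x ∈ tsupport χ
    · have hxs : x ∈ interior s := hball (by rwa [χ.tsupport_eq] at hx)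
      exact χ.contDiff.contDiffAt.smul (hF.contDiffAt (mem_interior_iff_mem_nhds.1 hxs))
    · refine contDiffAt_const (c := (0 : G)) |>.congr_of_eventuallyEq ?_
      filter_upwards [notMem_tsupport_iff_eventuallyEq.1 hx] with y hy
      simp [hy]
  · filter_upwards [Metric.closedBall_mem_nhds x₀ χ.rIn_pos] with x hx
    simp [χ.one_of_mem_closedBall hx]

/-- The mean value of `F` on the segment from `x - τ x • e` to `x`. -/
noncomputable def segmentAverage (τ : E → ℝ) (e : E) (F : E → G) (x : E) : G :=
  ∫ r in (0 : ℝ)..1, F (x + ((r - 1) * τ x) • e)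

theorem contDiffOn_segmentAverage {n : ℕ∞} {s : Set E} (hs : IsOpen s) {e : E}
    (hse : ∀ x ∈ s, ∀ r : ℝ, x + r • e ∈ s) {τ : E → ℝ} (hτ : ContDiffOn ℝ n τ s) {F : E → G}
    (hF : ContDiffOn ℝ n F s) : ContDiffOn ℝ n (segmentAverage τ e F) s := by
  refine contDiffOn_parametric_intervalIntegral hs
    (F := fun z : E × ℝ => F (z.1 + ((z.2 - 1) * τ z.1) • e))
    (hF.comp ?_ fun z hz => hse z.1 hz.1 _) zero_le_one
  exact contDiffOn_fst.add (((contDiffOn_snd.sub contDiffOn_const).mul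
    (hτ.comp contDiffOn_fst fun z hz => hz.1)).smul contDiffOn_const)

theorem smul_segmentAverage_fderiv [CompleteSpace G] {s : Set E} (hs : IsOpen s) {e : E}
    (hse : ∀ x ∈ s, ∀ r : ℝ, x + r • e ∈ s) {f : E → G} (hf : ContDiffOn ℝ 1 f s) (τ : E → ℝ)
    {x : E} (hx : x ∈ s) :
    τ x • segmentAverage τ e (fun y => fderiv ℝ f y e) x = f x - f (x - τ x • e) := by
  have hderiv (r : ℝ) : HasDerivAt (fun r : ℝ => f (x + ((r - 1) * τ x) • e))
      (τ x • fderiv ℝ f (x + ((r - 1) * τ x) • e) e) r := by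
    have hline : HasDerivAt (fun r : ℝ => x + ((r - 1) * τ x) • e) (τ x • e) r := by
      simpa using ((((hasDerivAt_id r).sub_const 1).mul_const (τ x)).smul_const e).const_add x
    have hf' := (hf.contDiffAt (hs.mem_nhds (hse x hx ((r - 1) * τ x)))).differentiableAt
      one_ne_zero
    simpa [Function.comp_def] using hf'.hasFDerivAt.comp_hasDerivAt r hline
  have hcont : Continuous fun r : ℝ => τ x • fderiv ℝ f (x + ((r - 1) * τ x) • e) e :=
    (((hf.continuousOn_fderiv_of_isOpen hs le_rfl).comp_continuous (by fun_prop)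
      fun r => hse x hx _).clm_apply continuous_const).const_smul _
  rw [segmentAverage, ← intervalIntegral.integral_smul,
    intervalIntegral.integral_eq_sub_of_hasDerivAt (fun r _ => hderiv r)
      (hcont.intervalIntegrable 0 1)]
  simp [sub_eq_add_neg]

theorem exists_contDiffOn_eq_smul [CompleteSpace G] {s : Set E} (hs : IsOpen s) {e : E}
    (hse : ∀ x ∈ s, ∀ r : ℝ, x + r • e ∈ s) {τ : E → ℝ} (hτ : ContDiffOn ℝ ∞ τ s) {f : E → G}
    (hf : ContDiffOn ℝ ∞ f s) (hfτ : ∀ x ∈ s, f (x - τ x • e) = 0) :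
    ∃ g : E → G, ContDiffOn ℝ ∞ g s ∧ (∀ x ∈ s, f x = τ x • g x) ∧
      ∀ x ∈ s, τ x = 0 → g x = fderiv ℝ f x e := by
  refine ⟨segmentAverage τ e fun y => fderiv ℝ f y e,
    contDiffOn_segmentAverage hs hse hτ
      ((hf.fderiv_of_isOpen hs (by simp)).clm_apply contDiffOn_const), fun x hx => ?_,
    fun x _ hτx => by simp [segmentAverage, hτx]⟩
  rw [smul_segmentAverage_fderiv hs hse (hf.of_le (by simp)) τ hx, hfτ x hx, sub_zero]

/-- The antiderivative of `F` in the direction `d` that vanishes on the kernel of `t`. -/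
noncomputable def antiderivAlong (t : E →L[ℝ] ℝ) (d : E) (F : E → G) (x : E) : G :=
  t x • segmentAverage t d F x

theorem antiderivAlong_zero (t : E →L[ℝ] ℝ) (d : E) (F : E → G) : antiderivAlong t d F 0 = 0 := by
  simp [antiderivAlong]

theorem contDiff_antiderivAlong {n : ℕ∞} (t : E →L[ℝ] ℝ) (d : E) {F : E → G}
    (hF : ContDiff ℝ n F) : ContDiff ℝ n (antiderivAlong t d F) :=
  t.contDiff.smul <| contDiffOn_univ.1 <| contDiffOn_segmentAverage isOpen_univ
    (fun _ _ _ => mem_univ _) t.contDiff.contDiffOn hF.contDiffOn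

theorem antiderivAlong_eq_intervalIntegral (t : E →L[ℝ] ℝ) (d : E) (F : E → G) (x : E) :
    antiderivAlong t d F x = ∫ s in (0 : ℝ)..t x, F (x + (s - t x) • d) := by
  have hscale := intervalIntegral.smul_integral_comp_mul_left
    (f := fun s => F (x + (s - t x) • d)) (t x) (a := 0) (b := 1)
  rw [mul_zero, mul_one] at hscale
  rw [← hscale, antiderivAlong, segmentAverage]
  congr 1
  refine intervalIntegral.integral_congr fun r _ => ?_
  congr 3
  ring

theorem fderiv_antiderivAlong [CompleteSpace G] {t : E →L[ℝ] ℝ} {d : E} (ht : t d = 1)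
    {F : E → G} (hF : ContDiff ℝ 1 F) (x : E) : fderiv ℝ (antiderivAlong t d F) x d = F x := by
  have hcont : Continuous fun s : ℝ => F (x + (s - t x) • d) := hF.continuous.comp (by fun_prop)
  have hline (r : ℝ) : antiderivAlong t d F (x + r • d) =
      ∫ s in (0 : ℝ)..(t x + r), F (x + (s - t x) • d) := by
    have htr : t (x + r • d) = t x + r := by simp [ht]
    rw [antiderivAlong_eq_intervalIntegral, htr]
    congr! 3
    module
  have hint : HasDerivAt (fun r : ℝ => antiderivAlong t d F (x + r • d)) (F x) 0 := by
    simp only [hline]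
    simpa using (intervalIntegral.integral_hasDerivAt_right (hcont.intervalIntegrable 0 (t x + 0))
      (hcont.stronglyMeasurableAtFilter _ _) hcont.continuousAt).comp_const_add (t x) 0
  have hdiff := ((contDiff_antiderivAlong (n := 1) t d hF).differentiable one_ne_zero x).hasFDerivAt
  exact (hdiff.hasLineDerivAt d).unique hint

/-- Averaging along `d` starts on the kernel of `t`, where `F` is `O(‖x - t x • d‖)`, and the
growth of `F` in the direction `d` contributes the quadratic term. -/
theorem exists_eventually_le_mul_of_hasStrictFDerivAt {t : E →L[ℝ] ℝ} {d : E} {F : E → ℝ}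
    {F' : E →L[ℝ] ℝ} (hF : HasStrictFDerivAt F F' 0) (hF0 : F 0 = 0) (hd : 0 < F' d) :
    ∃ C : ℝ, ∀ᶠ x in 𝓝 (0 : E), ∀ r ∈ Icc (0 : ℝ) 1,
      F' d / 2 * t x ^ 2 * r - C * ‖x - t x • d‖ * |t x| ≤
        t x * F (x + ((r - 1) * t x) • d) := by
  obtain ⟨C, U, hU, hLip⟩ := hF.exists_lipschitzOnWith
  have hd0 : d ≠ 0 := by
    rintro rfl
    simp at hd
  have hε : 0 < F' d / 2 / ‖d‖ := by positivity
  obtain ⟨δ, hδ, hball⟩ := Metric.eventually_nhds_iff_ball.1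
    ((hF.isLittleO.def hε).and (prod_mem_nhds hU hU))
  have hsmall : ∀ᶠ x in 𝓝 (0 : E), |t x| * ‖d‖ + ‖x - t x • d‖ < δ :=
    (by fun_prop : Continuous fun x : E => |t x| * ‖d‖ + ‖x - t x • d‖).continuousAt.eventually_lt
      continuousAt_const (by simpa using hδ)
  refine ⟨C, hsmall.mono fun x hx r hr => ?_⟩
  set w := x - t x • d
  set z := x + ((r - 1) * t x) • d
  have hzw : z - w = (r * t x) • d := by simp only [z, w]; module
  have hzw_norm : ‖z - w‖ = r * |t x| * ‖d‖ := by
    rw [hzw, norm_smul, Real.norm_eq_abs, abs_mul, abs_of_nonneg hr.1]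
  have htd : 0 ≤ |t x| * ‖d‖ := by positivity
  have hmem : (z, w) ∈ Metric.ball (0 : E × E) δ := by
    have hz : ‖z‖ ≤ ‖z - w‖ + ‖w‖ := by simpa using norm_add_le (z - w) w
    rw [mem_ball_zero_iff, Prod.norm_mk, max_lt_iff]
    constructor <;> nlinarith [hr.2]
  obtain ⟨hgrow, -, hwU⟩ := hball _ hmem
  have hw : |F w| ≤ C * ‖w‖ := by
    simpa [hF0] using hLip.norm_sub_le hwU (mem_of_mem_nhds hU)
  have hz : |F z - F w - r * t x * F' d| ≤ F' d / 2 * (r * |t x|) := by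
    have hε_eq : F' d / 2 / ‖d‖ * (r * |t x| * ‖d‖) = F' d / 2 * (r * |t x|) := by
      field_simp [norm_ne_zero_iff.2 hd0]
    simpa [hzw, norm_smul, abs_of_nonneg hr.1, hε_eq] using hgrow
  have hdev : |t x * (F z - r * t x * F' d)| ≤
      |t x| * (F' d / 2 * (r * |t x|) + C * ‖w‖) := by
    rw [abs_mul]
    refine mul_le_mul_of_nonneg_left ?_ (abs_nonneg _)
    calc |F z - r * t x * F' d| = |(F z - F w - r * t x * F' d) + F w| := by ring_nf
      _ ≤ _ := (abs_add_le _ _).trans (add_le_add hz hw)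
  have hlow := (abs_le.1 hdev).1
  have hexpand : |t x| * (F' d / 2 * (r * |t x|) + C * ‖w‖) =
      F' d / 2 * t x ^ 2 * r + C * ‖w‖ * |t x| := by
    rw [← sq_abs (t x)]
    ring
  rw [hexpand] at hlow
  linarith

theorem exists_eventually_le_antiderivAlong {t : E →L[ℝ] ℝ} {d : E} {F : E → ℝ}
    {F' : E →L[ℝ] ℝ} (hcont : Continuous F) (hF : HasStrictFDerivAt F F' 0) (hF0 : F 0 = 0)
    (hd : 0 < F' d) :
    ∃ C : ℝ, ∀ᶠ x in 𝓝 (0 : E),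
      F' d / 4 * t x ^ 2 - C * ‖x - t x • d‖ * |t x| ≤ antiderivAlong t d F x := by
  obtain ⟨C, hC⟩ := exists_eventually_le_mul_of_hasStrictFDerivAt (t := t) hF hF0 hd
  refine ⟨C, hC.mono fun x hx => ?_⟩
  have hint : ∫ r in (0 : ℝ)..1, (F' d / 2 * t x ^ 2 * r - C * ‖x - t x • d‖ * |t x|) =
      F' d / 4 * t x ^ 2 - C * ‖x - t x • d‖ * |t x| := by
    rw [intervalIntegral.integral_sub (Continuous.intervalIntegrable (by fun_prop) _ _)
      (continuous_const.intervalIntegrable _ _), intervalIntegral.integral_const_mul, integral_id,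
      intervalIntegral.integral_const]
    simp only [smul_eq_mul]
    ring
  rw [← hint, antiderivAlong, segmentAverage, ← intervalIntegral.integral_smul]
  exact intervalIntegral.integral_mono_on zero_le_one
    (Continuous.intervalIntegrable (by fun_prop) _ _)
    (Continuous.intervalIntegrable (by fun_prop) _ _) hx

theorem exists_eventually_antiderivAlong_add_pos {t : E →L[ℝ] ℝ} {d : E} {F : E → ℝ}
    {F' : E →L[ℝ] ℝ} (hcont : Continuous F) (hF : HasStrictFDerivAt F F' 0) (hF0 : F 0 = 0)
    (hd : 0 < F' d) :
    ∃ k : ℝ, ∀ᶠ x in 𝓝[≠] (0 : E), 0 < antiderivAlong t d F x + k * ‖x - t x • d‖ ^ 2 := by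
  obtain ⟨C, hC⟩ := exists_eventually_le_antiderivAlong (t := t) hcont hF hF0 hd
  refine ⟨2 * C ^ 2 / F' d + 1, eventually_nhdsWithin_iff.2 (hC.mono fun x hx hx0 => ?_)⟩
  have hpos : 0 < F' d / 8 * t x ^ 2 + ‖x - t x • d‖ ^ 2 := by
    by_cases htx : t x = 0
    · simpa [htx] using pow_pos (norm_pos_iff.2 hx0) 2
    · positivity
  have hsq : 0 ≤ F' d / 8 * (|t x| - 4 * C / F' d * ‖x - t x • d‖) ^ 2 := by positivity
  have hexpand : F' d / 8 * (|t x| - 4 * C / F' d * ‖x - t x • d‖) ^ 2 =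
      F' d / 8 * t x ^ 2 - C * ‖x - t x • d‖ * |t x| +
        2 * C ^ 2 / F' d * ‖x - t x • d‖ ^ 2 := by
    rw [← sq_abs (t x)]
    field_simp
    ring
  linarith

theorem exists_contDiff_fderiv_eventuallyEq [CompleteSpace G] [FiniteDimensional ℝ E]
    {s : Set E} (hs : s ∈ 𝓝 0) {F : E → G} (hF : ContDiffOn ℝ ∞ F s) {d : E} (hd : d ≠ 0) :
    ∃ f : E → G, ContDiff ℝ ∞ f ∧ f 0 = 0 ∧ ∀ᶠ x in 𝓝 0, fderiv ℝ f x d = F x := by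
  obtain ⟨t, ht⟩ := SeparatingDual.exists_eq_one (R := ℝ) hd
  obtain ⟨F', hF', -, hFF'⟩ := exists_contDiff_eventuallyEq hs hF
  exact ⟨antiderivAlong t d F', contDiff_antiderivAlong t d hF', antiderivAlong_zero t d F',
    hFF'.mono fun x hx => (fderiv_antiderivAlong ht (hF'.of_le (by simp)) x).trans hx⟩

theorem exists_contDiff_pos_fderiv_eventuallyEq {E : Type*} [NormedAddCommGroup E]
    [InnerProductSpace ℝ E] [FiniteDimensional ℝ E] {s : Set E} (hs : s ∈ 𝓝 0) {F : E → ℝ}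
    (hF : ContDiffOn ℝ ∞ F s) (hF0 : F 0 = 0) {d : E} (hd : 0 < fderiv ℝ F 0 d) :
    ∃ f : E → ℝ, ContDiff ℝ ∞ f ∧ f 0 = 0 ∧ (∀ᶠ x in 𝓝 0, fderiv ℝ f x d = F x) ∧
      ∀ᶠ x in 𝓝[≠] 0, 0 < f x := by
  obtain ⟨t, ht⟩ := SeparatingDual.exists_eq_one (R := ℝ) (x := d) (by rintro rfl; simp at hd)
  obtain ⟨F', hF', -, hFF'⟩ := exists_contDiff_eventuallyEq hs hF
  have hstrict := hF'.contDiffAt.hasStrictFDerivAt (x := 0) (by simp)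
  rw [hFF'.fderiv_eq] at hstrict
  obtain ⟨k, hk⟩ := exists_eventually_antiderivAlong_add_pos (t := t) hF'.continuous hstrict
    (hFF'.eq_of_nhds.trans hF0) hd
  let L : E →L[ℝ] E := .id ℝ E - t.smulRight d
  have hLd : L d = 0 := by simp [L, ht]
  have hsquare (x : E) : HasFDerivAt (fun x => k * ‖L x‖ ^ 2) _ x :=
    (L.hasFDerivAt.norm_sq).const_mul k
  have hA := contDiff_antiderivAlong t d hF'
  refine ⟨fun x => antiderivAlong t d F' x + k * ‖L x‖ ^ 2,
    hA.add (contDiff_const.mul (L.contDiff.norm_sq ℝ)), by simp [antiderivAlong_zero],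
    hFF'.mono fun x hx => ?_, hk⟩
  have hsum := (hA.differentiable (by simp) x).hasFDerivAt.fun_add (hsquare x)
  rw [hsum.fderiv, ← hx, ← fderiv_antiderivAlong ht (hF'.of_le (by simp)) x]
  simp [hLd]

end Calculus

section SimpleHamiltonian

variable {E : Type*} [NormedAddCommGroup E] [NormedSpace ℝ E]

/-- `A` is a smooth field of inner products on the covectors at the points of `s`, each of them
given by the operator from covectors to vectors that represents it. -/
structure IsCometricOn (A : E → (E →L[ℝ] ℝ) →L[ℝ] E) (s : Set E) : Prop where
  symm : ∀ x ∈ s, ∀ p q : E →L[ℝ] ℝ, p (A x q) = q (A x p)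
  pos : ∀ x ∈ s, ∀ p : E →L[ℝ] ℝ, p ≠ 0 → 0 < p (A x p)
  smooth : ContDiffOn ℝ ∞ A s

/-- The coordinate expression `(x, p) ↦ ½⟨p, A(x) p⟩ + h(x)` of a simple function. -/
noncomputable def localSimple (A : E → (E →L[ℝ] ℝ) →L[ℝ] E) (h : E → ℝ)
    (z : E × (E →L[ℝ] ℝ)) : ℝ :=
  1 / 2 * z.2 (A z.1 z.2) + h z.1

variable {A : E → (E →L[ℝ] ℝ) →L[ℝ] E} {h : E → ℝ} {s : Set E}

theorem differentiableAt_of_contDiffOn {F : Type*} [NormedAddCommGroup F] [NormedSpace ℝ F]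
    {f : E → F} (hs : IsOpen s) (hf : ContDiffOn ℝ ∞ f s) {x : E} (hx : x ∈ s) :
    DifferentiableAt ℝ f x :=
  (hf.contDiffAt (hs.mem_nhds hx)).differentiableAt (by simp)

theorem IsCometricOn.differentiableAt (hA : IsCometricOn A s) (hs : IsOpen s) {x : E}
    (hx : x ∈ s) : DifferentiableAt ℝ A x :=
  differentiableAt_of_contDiffOn hs hA.smooth hx

theorem contDiffOn_comp_fst {F G : Type*} [NormedAddCommGroup F] [NormedSpace ℝ F]
    [NormedAddCommGroup G] [NormedSpace ℝ G] {f : E → F} (hf : ContDiffOn ℝ ∞ f s) :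
    ContDiffOn ℝ ∞ (fun z : E × G => f z.1) (s ×ˢ univ) :=
  hf.comp contDiffOn_fst fun _ hz => hz.1

theorem contDiffOn_localSimple (hA : ContDiffOn ℝ ∞ A s) (hh : ContDiffOn ℝ ∞ h s) :
    ContDiffOn ℝ ∞ (localSimple A h) (s ×ˢ univ) :=
  (contDiffOn_const.mul (contDiffOn_snd.clm_apply
    ((contDiffOn_comp_fst hA).clm_apply contDiffOn_snd))).add (contDiffOn_comp_fst hh)

theorem localSimple_pos {v : E → ℝ} (hA : IsCometricOn A s) (hv0 : v 0 = 0)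
    (hv : ∀ x ∈ s, x ≠ 0 → 0 < v x) {z : E × (E →L[ℝ] ℝ)} (hz : z.1 ∈ s) (hz0 : z ≠ 0) :
    0 < localSimple A v z := by
  obtain ⟨x, p⟩ := z
  rcases eq_or_ne p 0 with rfl | hp
  · have hx : x ≠ 0 := by
      rintro rfl
      exact hz0 rfl
    simpa [localSimple] using hv x hz hx
  · have hvx : 0 ≤ v x := by
      rcases eq_or_ne x 0 with rfl | hx
      exacts [hv0.ge, (hv x hz hx).le]
    have := hA.pos x hz p hp
    unfold localSimple
    positivity

theorem fderiv_localSimple {z : E × (E →L[ℝ] ℝ)} (hA : DifferentiableAt ℝ A z.1)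
    (hsymm : ∀ p q : E →L[ℝ] ℝ, p (A z.1 q) = q (A z.1 p)) (hh : DifferentiableAt ℝ h z.1)
    (w : E × (E →L[ℝ] ℝ)) :
    fderiv ℝ (localSimple A h) z w =
      1 / 2 * z.2 (fderiv ℝ A z.1 w.1 z.2) + fderiv ℝ h z.1 w.1 + w.2 (A z.1 z.2) := by
  have hbase := HasFDerivAt.comp (g := A) z hA.hasFDerivAt (hasFDerivAt_fst (𝕜 := ℝ) (p := z))
  have hpotential := HasFDerivAt.comp (g := h) z hh.hasFDerivAt (hasFDerivAt_fst (𝕜 := ℝ) (p := z))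
  have hkinetic := (hasFDerivAt_snd (𝕜 := ℝ) (p := z)).clm_apply (hbase.clm_apply hasFDerivAt_snd)
  have hsum : HasFDerivAt (localSimple A h) _ z := (hkinetic.const_mul (1 / 2)).add hpotential
  rw [hsum.fderiv]
  simp [hsymm z.2 w.2]
  ring

theorem fderiv_localSimple_eq_zero {x : E} (hA : DifferentiableAt ℝ A x)
    (hsymm : ∀ p q : E →L[ℝ] ℝ, p (A x q) = q (A x p)) (hh : DifferentiableAt ℝ h x)
    (hcrit : fderiv ℝ h x = 0) : fderiv ℝ (localSimple A h) (x, 0) = 0 :=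
  ContinuousLinearMap.ext fun w => by
    rw [fderiv_localSimple hA hsymm hh, hcrit]
    simp

end SimpleHamiltonian

section CanonicalForm

theorem isInvertible_of_nondegenerate {E : Type*} [NormedAddCommGroup E] [NormedSpace ℝ E]
    [FiniteDimensional ℝ E] (B : E →L[ℝ] E →L[ℝ] ℝ) (hB : ∀ x, (∀ y, B x y = 0) → x = 0) :
    B.IsInvertible := by
  have hinj : Function.Injective B.toLinearMap :=
    (injective_iff_map_eq_zero _).2 fun x hx => hB x fun y => DFunLike.congr_fun hx y
  have hdim : Module.finrank ℝ E = Module.finrank ℝ (E →L[ℝ] ℝ) := by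
    rw [← (LinearMap.toContinuousLinearMap : (E →ₗ[ℝ] ℝ) ≃ₗ[ℝ] E →L[ℝ] ℝ).finrank_eq]
    exact Subspace.dual_finrank_eq.symm
  exact ⟨(LinearEquiv.ofInjectiveOfFinrankEq B.toLinearMap hinj hdim).toContinuousLinearEquiv, rfl⟩

theorem stdSymplectic_apply (x y : E2 × E2Dual) : stdSymplectic x y = y.2 x.1 - x.2 y.1 :=
  rfl

theorem stdSymplectic_nondegenerate (x : E2 × E2Dual) (hx : ∀ y, stdSymplectic x y = 0) :
    x = 0 := by
  refine Prod.ext ?_ ?_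
  · ext i
    simpa [stdSymplectic_apply] using hx (0, EuclideanSpace.proj i)
  · ext v
    simpa [stdSymplectic_apply] using hx (v, 0)

theorem isInvertible_stdSymplectic : stdSymplectic.IsInvertible :=
  isInvertible_of_nondegenerate stdSymplectic stdSymplectic_nondegenerate

/-- The Hamiltonian vector field of `K` for the symplectic form `dqⁱ ∧ dpᵢ`. -/
noncomputable def stdHamiltonianVF (K : E2 × E2Dual → ℝ) (z : E2 × E2Dual) : E2 × E2Dual :=
  stdSymplectic.inverse (fderiv ℝ K z)

theorem contDiffOn_clm_fderiv {E F : Type*} [NormedAddCommGroup E] [NormedSpace ℝ E]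
    [NormedAddCommGroup F] [NormedSpace ℝ F] (L : (E →L[ℝ] ℝ) →L[ℝ] F) {K : E → ℝ} {s : Set E}
    (hs : IsOpen s) (hK : ContDiffOn ℝ ∞ K s) : ContDiffOn ℝ ∞ (fun z => L (fderiv ℝ K z)) s :=
  L.contDiff.comp_contDiffOn (hK.fderiv_of_isOpen hs (by simp))

theorem contDiffOn_stdHamiltonianVF {K : E2 × E2Dual → ℝ} {s : Set (E2 × E2Dual)}
    (hs : IsOpen s) (hK : ContDiffOn ℝ ∞ K s) : ContDiffOn ℝ ∞ (stdHamiltonianVF K) s :=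
  contDiffOn_clm_fderiv _ hs hK

theorem stdHamiltonianVF_eq_of_forall {K : E2 × E2Dual → ℝ} {z w : E2 × E2Dual}
    (hw : ∀ y, stdSymplectic w y = fderiv ℝ K z y) : stdHamiltonianVF K z = w := by
  rw [stdHamiltonianVF, ← ContinuousLinearMap.ext hw]
  exact DFunLike.congr_fun isInvertible_stdSymplectic.inverse_comp_self w

theorem stdHamiltonianVF_eq_zero {K : E2 × E2Dual → ℝ} {z : E2 × E2Dual}
    (hK : fderiv ℝ K z = 0) : stdHamiltonianVF K z = 0 :=
  stdHamiltonianVF_eq_of_forall fun y => by rw [hK, ContinuousLinearMap.map_zero]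

theorem stdHamiltonianVF_localSimple {A : E2 → E2Dual →L[ℝ] E2} {h : E2 → ℝ} {z : E2 × E2Dual}
    (hA : DifferentiableAt ℝ A z.1)
    (hsymm : ∀ p q : E2Dual, p (A z.1 q) = q (A z.1 p)) (hh : DifferentiableAt ℝ h z.1) :
    stdHamiltonianVF (localSimple A h) z =
      (A z.1 z.2, -((1 / 2 : ℝ) • z.2.comp ((fderiv ℝ A z.1).flip z.2) + fderiv ℝ h z.1)) := by
  refine stdHamiltonianVF_eq_of_forall fun y => ?_
  rw [stdSymplectic_apply, fderiv_localSimple hA hsymm hh]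
  simp
  ring

end CanonicalForm

local notation "𝐞₀" => (EuclideanSpace.single (0 : Fin 2) (1 : ℝ) : E2)
local notation "𝐝₀" => (EuclideanSpace.proj (0 : Fin 2) : E2Dual)
local notation "𝐝₁" => (EuclideanSpace.proj (1 : Fin 2) : E2Dual)

section Matching

theorem fderiv_apply_eq_partialDeriv (f : E2 → ℝ) (x d : E2) :
    fderiv ℝ f x d = d 0 * partialDeriv 0 f x + d 1 * partialDeriv 1 f x := by
  have hd : d = d 0 • EuclideanSpace.single 0 (1 : ℝ) + d 1 • EuclideanSpace.single 1 (1 : ℝ) := by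
    ext i
    fin_cases i <;> simp
  conv_lhs => rw [hd]
  simp [partialDeriv]

theorem contDiffOn_fderiv_apply {E F : Type*} [NormedAddCommGroup E] [NormedSpace ℝ E]
    [NormedAddCommGroup F] [NormedSpace ℝ F] {s : Set E} (hs : IsOpen s) {f : E → F}
    (hf : ContDiffOn ℝ ∞ f s) (e : E) : ContDiffOn ℝ ∞ (fun x => fderiv ℝ f x e) s :=
  (hf.fderiv_of_isOpen hs (by simp)).clm_apply contDiffOn_const

theorem contDiffOn_partialDeriv {s : Set E2} (hs : IsOpen s) {f : E2 → ℝ}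
    (hf : ContDiffOn ℝ ∞ f s) (i : Fin 2) : ContDiffOn ℝ ∞ (partialDeriv i f) s :=
  contDiffOn_fderiv_apply hs hf _

theorem covector_eq (p : E2Dual) :
    p = p (EuclideanSpace.single 0 1) • 𝐝₀ + p (EuclideanSpace.single 1 1) • 𝐝₁ := by
  ext v
  have hv : v = v 0 • EuclideanSpace.single 0 (1 : ℝ) + v 1 • EuclideanSpace.single 1 (1 : ℝ) := by
    ext i
    fin_cases i <;> simp
  conv_lhs => rw [hv]
  simp [mul_comm]

/-- The covector `dx + k dy`. -/
noncomputable def slopeCovector (k : ℝ) : E2Dual := 𝐝₀ + k • 𝐝₁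

/-- The matching conditions at `x` for the Hamiltonian with kinetic operator `A` and potential `h`:
the kinetic and the potential part of the requirement that the derivative of
`½(p_x²/α + α(p_y - κ p_x)²) + v` along the Hamiltonian vector field vanish where `p_y = κ p_x`. -/
structure MatchingConditions (A : E2 → E2Dual →L[ℝ] E2) (h κ α v : E2 → ℝ) (x : E2) : Prop where
  kinetic : fderiv ℝ α x (A x (slopeCovector (κ x))) =
    -α x * slopeCovector (κ x) (fderiv ℝ A x 𝐞₀ (slopeCovector (κ x)))
  potential : α x * fderiv ℝ v x (A x (slopeCovector (κ x))) = fderiv ℝ h x 𝐞₀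

theorem exists_direction {a b c hxx hxy : ℝ} (hc : 0 < c) (hdet : 0 < a * c - b ^ 2)
    (h : b * hxx + c * hxy ≠ 0 ∨ 0 < hxx) :
    ∃ d : E2, 0 < d 0 * c - d 1 * b ∧ 0 < d 0 * hxx + d 1 * hxy := by
  rcases h with h | h
  · -- `d = A (dx + μ dy)`, and `μ` is chosen so that the second quantity equals `1`.
    let μ : ℝ := (1 - (a * hxx + b * hxy)) / (b * hxx + c * hxy)
    have hμ : μ * (b * hxx + c * hxy) = 1 - (a * hxx + b * hxy) := div_mul_cancel₀ _ h
    refine ⟨!₂[a + b * μ, b + c * μ], ?_, ?_⟩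
    · simp only [Matrix.cons_val_zero, Matrix.cons_val_one]
      linarith
    · simp only [Matrix.cons_val_zero, Matrix.cons_val_one]
      linarith
  · exact ⟨!₂[1, 0], by simpa using hc, by simpa using h⟩

namespace IsCometricOn

variable {A : E2 → E2Dual →L[ℝ] E2} {s : Set E2} {x : E2}

theorem coeff_one_one_pos (hA : IsCometricOn A s) (hx : x ∈ s) : 0 < A x 𝐝₁ 1 :=
  hA.pos x hx 𝐝₁ fun h => by simpa using DFunLike.congr_fun h (EuclideanSpace.single 1 1)

theorem coeff_symm (hA : IsCometricOn A s) (hx : x ∈ s) : A x 𝐝₀ 1 = A x 𝐝₁ 0 :=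
  hA.symm x hx 𝐝₁ 𝐝₀

theorem det_pos (hA : IsCometricOn A s) (hx : x ∈ s) :
    0 < A x 𝐝₀ 0 * A x 𝐝₁ 1 - A x 𝐝₁ 0 ^ 2 := by
  have hc := hA.coeff_one_one_pos hx
  have hp : A x 𝐝₁ 1 • 𝐝₀ - A x 𝐝₁ 0 • 𝐝₁ ≠ 0 := fun h => by
    simpa [hc.ne'] using DFunLike.congr_fun h 𝐞₀
  have hpos := hA.pos x hx _ hp
  have hvalue : (A x 𝐝₁ 1 • 𝐝₀ - A x 𝐝₁ 0 • 𝐝₁) (A x (A x 𝐝₁ 1 • 𝐝₀ - A x 𝐝₁ 0 • 𝐝₁)) =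
      A x 𝐝₁ 1 * (A x 𝐝₀ 0 * A x 𝐝₁ 1 - A x 𝐝₁ 0 ^ 2) := by
    simp [hA.coeff_symm hx]
    ring
  exact (pos_iff_pos_of_mul_pos (hvalue ▸ hpos)).1 hc

theorem exists_slopeCovector_eq_smul (hs : IsOpen s) (h0 : 0 ∈ s) (hA : IsCometricOn A s) {d : E2}
    (hd : 0 < d 0 * A 0 𝐝₁ 1 - d 1 * A 0 𝐝₁ 0) :
    ∃ (W : Set E2) (κ μ : E2 → ℝ), IsOpen W ∧ 0 ∈ W ∧ W ⊆ s ∧ ContDiffOn ℝ ∞ κ W ∧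
      ContDiffOn ℝ ∞ μ W ∧ ∀ x ∈ W, 0 < μ x ∧ A x (slopeCovector (κ x)) = μ x • d := by
  have hcoeff (p : E2Dual) (i : Fin 2) : ContDiffOn ℝ ∞ (fun x => A x p i) s :=
    (EuclideanSpace.proj (𝕜 := ℝ) i).contDiff.comp_contDiffOn (hA.smooth.clm_apply contDiffOn_const)
  let D (x : E2) : ℝ := d 0 * A x 𝐝₁ 1 - d 1 * A x 𝐝₁ 0
  have hD : ContDiffOn ℝ ∞ D s :=
    (contDiffOn_const.mul (hcoeff 𝐝₁ 1)).sub (contDiffOn_const.mul (hcoeff 𝐝₁ 0))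
  have hDs : s ∩ D ⁻¹' Ioi 0 ⊆ s := inter_subset_left
  refine ⟨s ∩ D ⁻¹' Ioi 0, fun x => (d 1 * A x 𝐝₀ 0 - d 0 * A x 𝐝₁ 0) / D x,
    fun x => (A x 𝐝₀ 0 * A x 𝐝₁ 1 - A x 𝐝₁ 0 ^ 2) / D x,
    hD.continuousOn.isOpen_inter_preimage hs isOpen_Ioi, ⟨h0, hd⟩, hDs, ?_, ?_, fun x hx => ?_⟩
  · exact (((contDiffOn_const.mul (hcoeff 𝐝₀ 0)).sub
      (contDiffOn_const.mul (hcoeff 𝐝₁ 0))).mono hDs).div (hD.mono hDs) fun x hx => hx.2.ne'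
  · exact ((((hcoeff 𝐝₀ 0).mul (hcoeff 𝐝₁ 1)).sub ((hcoeff 𝐝₁ 0).pow 2)).mono hDs).div
      (hD.mono hDs) fun x hx => hx.2.ne'
  · refine ⟨div_pos (hA.det_pos hx.1) hx.2, ?_⟩
    have hDx : D x ≠ 0 := hx.2.ne'
    have hsymm := hA.coeff_symm hx.1
    ext i
    fin_cases i <;> simp [slopeCovector] <;> field_simp <;> simp only [hsymm, D] <;> ring

end IsCometricOn

theorem contDiffOn_slopeCovector {s : Set E2} {κ : E2 → ℝ} (hκ : ContDiffOn ℝ ∞ κ s) :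
    ContDiffOn ℝ ∞ (fun x => slopeCovector (κ x)) s :=
  contDiffOn_const.add (hκ.smul contDiffOn_const)

theorem exists_matching_weight {A : E2 → E2Dual →L[ℝ] E2} {W : Set E2} (hW : IsOpen W)
    (h0 : 0 ∈ W) (hA : ContDiffOn ℝ ∞ A W) {κ μ : E2 → ℝ} (hκ : ContDiffOn ℝ ∞ κ W)
    (hμ : ContDiffOn ℝ ∞ μ W) {d : E2} (hd : d ≠ 0)
    (hμd : ∀ x ∈ W, 0 < μ x ∧ A x (slopeCovector (κ x)) = μ x • d) :
    ∃ α : E2 → ℝ, ContDiff ℝ ∞ α ∧ (∀ x, 0 < α x) ∧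
      ∀ᶠ x in 𝓝 0, fderiv ℝ α x (A x (slopeCovector (κ x))) =
        -α x * slopeCovector (κ x) (fderiv ℝ A x 𝐞₀ (slopeCovector (κ x))) := by
  have hω := contDiffOn_slopeCovector hκ
  have hS : ContDiffOn ℝ ∞
      (fun x => slopeCovector (κ x) (fderiv ℝ A x 𝐞₀ (slopeCovector (κ x))) / μ x) W :=
    (hω.clm_apply ((contDiffOn_fderiv_apply hW hA 𝐞₀).clm_apply hω)).div hμ
      fun x hx => (hμd x hx).1.ne'
  obtain ⟨f, hf, -, hfd⟩ := exists_contDiff_fderiv_eventuallyEq (hW.mem_nhds h0) hS hd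
  refine ⟨fun x => Real.exp (-f x), hf.neg.exp, fun x => Real.exp_pos _, ?_⟩
  filter_upwards [hfd, hW.mem_nhds h0] with x hx hxW
  obtain ⟨hμpos, hAω⟩ := hμd x hxW
  have hexp := (hf.differentiable (by simp) x).hasFDerivAt.fun_neg.exp
  rw [hexp.fderiv, hAω]
  simp only [smul_apply, neg_apply, map_smul, smul_eq_mul, hx]
  field_simp

theorem exists_matching_potential {A : E2 → E2Dual →L[ℝ] E2} {W : Set E2} (hW : IsOpen W)
    (h0 : 0 ∈ W) {h κ α μ : E2 → ℝ} (hh : ContDiffOn ℝ ∞ h W) (hcrit : partialDeriv 0 h 0 = 0)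
    (hα : ContDiff ℝ ∞ α) (hαpos : ∀ x, 0 < α x) (hμ : ContDiffOn ℝ ∞ μ W) {d : E2}
    (hμd : ∀ x ∈ W, 0 < μ x ∧ A x (slopeCovector (κ x)) = μ x • d)
    (hd : 0 < fderiv ℝ (partialDeriv 0 h) 0 d) :
    ∃ v : E2 → ℝ, ContDiff ℝ ∞ v ∧ v 0 = 0 ∧ (∀ᶠ x in 𝓝[≠] 0, 0 < v x) ∧
      ∀ᶠ x in 𝓝 0, α x * fderiv ℝ v x (A x (slopeCovector (κ x))) = fderiv ℝ h x 𝐞₀ := by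
  have hpos (x : E2) (hx : x ∈ W) : 0 < (μ x * α x)⁻¹ :=
    inv_pos.2 (mul_pos (hμd x hx).1 (hαpos x))
  have hfactor : ContDiffOn ℝ ∞ (fun x => (μ x * α x)⁻¹) W :=
    (hμ.mul hα.contDiffOn).inv fun x hx => (inv_pos.1 (hpos x hx)).ne'
  have hpartial := contDiffOn_partialDeriv hW hh 0
  have hderiv : fderiv ℝ (fun x => (μ x * α x)⁻¹ * partialDeriv 0 h x) 0 d =
      (μ 0 * α 0)⁻¹ * fderiv ℝ (partialDeriv 0 h) 0 d := by
    rw [fderiv_fun_mul ((hfactor.contDiffAt (hW.mem_nhds h0)).differentiableAt (by simp))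
      ((hpartial.contDiffAt (hW.mem_nhds h0)).differentiableAt (by simp))]
    simp [hcrit]
  obtain ⟨v, hv, hv0, hvd, hvpos⟩ :=
    exists_contDiff_pos_fderiv_eventuallyEq (hW.mem_nhds h0) (hfactor.mul hpartial)
      (by simp [hcrit]) (hderiv ▸ mul_pos (hpos 0 h0) hd)
  refine ⟨v, hv, hv0, hvpos, ?_⟩
  filter_upwards [hvd, hW.mem_nhds h0] with x hx hxW
  obtain ⟨hμpos, hAω⟩ := hμd x hxW
  have hαx := hαpos x
  rw [hAω, map_smul, hx, smul_eq_mul, partialDeriv]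
  field_simp

theorem exists_matchingConditions {A : E2 → E2Dual →L[ℝ] E2} {Ω : Set E2} (hΩ : IsOpen Ω)
    (h0 : 0 ∈ Ω) (hA : IsCometricOn A Ω) {h : E2 → ℝ} (hh : ContDiffOn ℝ ∞ h Ω)
    (hcrit : fderiv ℝ h 0 = 0)
    (hpos : A 0 𝐝₁ 0 * partialDeriv 0 (partialDeriv 0 h) 0 +
        A 0 𝐝₁ 1 * partialDeriv 1 (partialDeriv 0 h) 0 ≠ 0 ∨
      0 < partialDeriv 0 (partialDeriv 0 h) 0) :
    ∃ (U : Set E2) (κ α v : E2 → ℝ), IsOpen U ∧ 0 ∈ U ∧ U ⊆ Ω ∧ ContDiffOn ℝ ∞ κ U ∧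
      ContDiff ℝ ∞ α ∧ (∀ x, 0 < α x) ∧ ContDiff ℝ ∞ v ∧ v 0 = 0 ∧
      (∀ x ∈ U, x ≠ 0 → 0 < v x) ∧ ∀ x ∈ U, MatchingConditions A h κ α v x := by
  obtain ⟨d, hdA, hdh⟩ := exists_direction (hA.coeff_one_one_pos h0) (hA.det_pos h0) hpos
  obtain ⟨W, κ, μ, hW, h0W, hWΩ, hκ, hμ, hμd⟩ := hA.exists_slopeCovector_eq_smul hΩ h0 hdA
  rw [← fderiv_apply_eq_partialDeriv] at hdh
  obtain ⟨α, hα, hαpos, hkinetic⟩ := exists_matching_weight hW h0W (hA.smooth.mono hWΩ) hκ hμ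
    (by rintro rfl; simp at hdh) hμd
  obtain ⟨v, hv, hv0, hvpos, hpotential⟩ := exists_matching_potential hW h0W (hh.mono hWΩ)
    (by simp [partialDeriv, hcrit]) hα hαpos hμ hμd hdh
  obtain ⟨U, hU, hUopen, h0U⟩ := eventually_nhds_iff.1
    ((hkinetic.and hpotential).and ((eventually_nhdsWithin_iff.1 hvpos).and (hW.mem_nhds h0W)))
  exact ⟨U, κ, α, v, hUopen, h0U, fun x hx => hWΩ (hU x hx).2.2,
    hκ.mono fun x hx => (hU x hx).2.2, hα, hαpos, hv, hv0, fun x hx => (hU x hx).2.1,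
    fun x hx => ⟨(hU x hx).1.1, (hU x hx).1.2⟩⟩

end Matching

section Metric

variable {E : Type*} [NormedAddCommGroup E] [NormedSpace ℝ E]

/-- `G` is a smooth Riemannian metric on the subset `s` of a normed space. -/
structure IsMetricOn (G : E → E →L[ℝ] E →L[ℝ] ℝ) (s : Set E) : Prop where
  symm : ∀ x ∈ s, ∀ u w : E, G x u w = G x w u
  pos : ∀ x ∈ s, ∀ u : E, u ≠ 0 → 0 < G x u u
  smooth : ContDiffOn ℝ ∞ G s

namespace IsMetricOn

variable [FiniteDimensional ℝ E] {G : E → E →L[ℝ] E →L[ℝ] ℝ} {s : Set E} {x : E}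

theorem isInvertible (hG : IsMetricOn G s) (hx : x ∈ s) : (G x).IsInvertible :=
  isInvertible_of_nondegenerate (G x) fun u hu => by
    by_contra hu0
    exact (hG.pos x hx u hu0).ne' (hu u)

theorem apply_inverse (hG : IsMetricOn G s) (hx : x ∈ s) (p : E →L[ℝ] ℝ) :
    G x ((G x).inverse p) = p :=
  DFunLike.congr_fun (hG.isInvertible hx).self_comp_inverse p

theorem inverse_apply (hG : IsMetricOn G s) (hx : x ∈ s) (u : E) : (G x).inverse (G x u) = u :=
  DFunLike.congr_fun (hG.isInvertible hx).inverse_comp_self u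

theorem isCometricOn_inverse (hG : IsMetricOn G s) : IsCometricOn (fun x => (G x).inverse) s where
  symm x hx p q := by
    conv_lhs => rw [← hG.apply_inverse hx p]
    rw [hG.symm x hx, hG.apply_inverse hx]
  pos x hx p hp := by
    have hu : (G x).inverse p ≠ 0 := fun hu => hp (by rw [← hG.apply_inverse hx p, hu, map_zero])
    simpa only [hG.apply_inverse hx] using hG.pos x hx _ hu
  smooth x hx := by
    have := FiniteDimensional.complete ℝ E
    exact ((hG.isInvertible hx).contDiffAt_map_inverse).comp_contDiffWithinAt x (hG.smooth x hx)

end IsMetricOn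

end Metric

section TwistedMetric

/-- The inner product on `ℝ²` whose dual is `p ↦ p_x²/α + α(p_y - k p_x)²`. -/
noncomputable def twistedMetric (α k : ℝ) : E2 →L[ℝ] E2 →L[ℝ] ℝ :=
  α • (slopeCovector k).smulRight (slopeCovector k) + α⁻¹ • (𝐝₁).smulRight 𝐝₁

theorem isMetricOn_twistedMetric {s : Set E2} {α κ : E2 → ℝ} (hα : ContDiffOn ℝ ∞ α s)
    (hαpos : ∀ x, 0 < α x) (hκ : ContDiffOn ℝ ∞ κ s) :
    IsMetricOn (fun x => twistedMetric (α x) (κ x)) s where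
  symm x _ u w := by
    simp [twistedMetric]
    ring
  pos x _ u hu := by
    have hvalue : twistedMetric (α x) (κ x) u u =
        α x * (u 0 + κ x * u 1) ^ 2 + (α x)⁻¹ * u 1 ^ 2 := by
      simp [twistedMetric, slopeCovector]
      ring
    have hαx := hαpos x
    rw [hvalue]
    rcases eq_or_ne (u 1) 0 with hu1 | hu1
    · have hu0 : u 0 ≠ 0 := fun hu0 => hu (by ext i; fin_cases i <;> assumption)
      rw [hu1]
      simp only [mul_zero, add_zero]
      positivity
    · positivity
  smooth := by
    have hω := contDiffOn_slopeCovector hκ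
    exact (hα.smul (hω.smulRight hω)).add ((hα.inv fun x _ => (hαpos x).ne').smul contDiffOn_const)

theorem twistedMetric_inverse_apply {α : ℝ} (hα : 0 < α) (k : ℝ) (p : E2Dual) :
    (twistedMetric α k).inverse p =
      !₂[α⁻¹ * p (EuclideanSpace.single 0 1) -
          α * k * (p (EuclideanSpace.single 1 1) - k * p (EuclideanSpace.single 0 1)),
        α * (p (EuclideanSpace.single 1 1) - k * p (EuclideanSpace.single 0 1))] := by
  have hmetric : IsMetricOn (fun _ : E2 => twistedMetric α k) univ :=
    isMetricOn_twistedMetric contDiffOn_const (fun _ => hα) contDiffOn_const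
  rw [← hmetric.inverse_apply (mem_univ 0) !₂[_, _]]
  congr 1
  conv_lhs => rw [covector_eq p]
  ext v
  simp [twistedMetric, slopeCovector]
  field_simp
  ring

end TwistedMetric

section Feedback

variable {E : Type*} [NormedAddCommGroup E] [NormedSpace ℝ E]

theorem fderiv_fderiv_apply_eq_zero {f : E → ℝ} {X : E → E} {x : E}
    (hf : ContDiffAt ℝ ∞ f x) (hX : DifferentiableAt ℝ X x) (hfx : fderiv ℝ f x = 0)
    (hXx : X x = 0) :
    fderiv ℝ (fun z => fderiv ℝ f z (X z)) x = 0 := by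
  have hf' : DifferentiableAt ℝ (fderiv ℝ f) x :=
    (hf.fderiv_right (m := ∞) (by simp)).differentiableAt (by simp)
  ext w
  simp [fderiv_clm_apply hf' hX, hfx, hXx]

theorem exists_feedback {D : Set E} (hD : IsOpen D) {e : E} (hDe : ∀ z ∈ D, ∀ r : ℝ, z + r • e ∈ D)
    {V τ β : E → ℝ} {X : E → E} (hV : ContDiffOn ℝ ∞ V D) (hX : ContDiffOn ℝ ∞ X D)
    (hτ : ContDiffOn ℝ ∞ τ D) (hβ : ContDiffOn ℝ ∞ β D) (hβ0 : ∀ z ∈ D, β z ≠ 0)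
    (hVe : ∀ z ∈ D, fderiv ℝ V z e = β z * τ z)
    (hVX : ∀ z ∈ D, fderiv ℝ V (z - τ z • e) (X (z - τ z • e)) = 0) {z₀ : E} (hz₀ : z₀ ∈ D)
    (hVz₀ : fderiv ℝ V z₀ = 0) (hXz₀ : X z₀ = 0) :
    ∃ u : E → ℝ, ContDiffOn ℝ ∞ u D ∧ u z₀ = 0 ∧ ∀ z ∈ D, fderiv ℝ V z (X z + u z • e) = 0 := by
  obtain ⟨g, hg, hgτ, hg0⟩ := exists_contDiffOn_eq_smul hD hDe hτ
    ((hV.fderiv_of_isOpen hD (by simp)).clm_apply hX) hVX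
  have hτz₀ : τ z₀ = 0 := by
    simpa [hVz₀, hβ0 z₀ hz₀] using hVe z₀ hz₀
  refine ⟨fun z => -(g z / β z), (hg.div hβ hβ0).neg, ?_, fun z hz => ?_⟩
  · simp [hg0 z₀ hz₀ hτz₀, fderiv_fderiv_apply_eq_zero (hV.contDiffAt (hD.mem_nhds hz₀))
      (differentiableAt_of_contDiffOn hD hX hz₀) hVz₀ hXz₀]
  · have hβz := hβ0 z hz
    rw [map_add, map_smul, hgτ z hz, hVe z hz, smul_eq_mul, smul_eq_mul]
    field_simp
    ring

end Feedback

section MatchedFeedback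

variable {A : E2 → E2Dual →L[ℝ] E2} {h κ α v : E2 → ℝ} {U : Set E2}

theorem twistedMetric_inverse_slopeCovector {a : ℝ} (ha : 0 < a) (k : ℝ) :
    (twistedMetric a k).inverse (slopeCovector k) = a⁻¹ • 𝐞₀ := by
  rw [twistedMetric_inverse_apply ha]
  ext i
  fin_cases i <;> simp [slopeCovector]

theorem fderiv_twistedMetric_inverse_slopeCovector {x : E2} (hα : DifferentiableAt ℝ α x)
    (hαpos : ∀ x, 0 < α x) (hκ : DifferentiableAt ℝ κ x)
    (hB : DifferentiableAt ℝ (fun x => (twistedMetric (α x) (κ x)).inverse) x) (w : E2) :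
    slopeCovector (κ x) (fderiv ℝ (fun x => (twistedMetric (α x) (κ x)).inverse) x w
      (slopeCovector (κ x))) = -fderiv ℝ α x w / α x ^ 2 := by
  have hform (y : E2) : slopeCovector (κ x) ((twistedMetric (α y) (κ y)).inverse
      (slopeCovector (κ x))) = (α y)⁻¹ + α y * (κ x - κ y) ^ 2 := by
    rw [twistedMetric_inverse_apply (hαpos y)]
    simp [slopeCovector]
    ring
  have hleft : HasFDerivAt (fun y => slopeCovector (κ x) ((twistedMetric (α y) (κ y)).inverse
      (slopeCovector (κ x)))) _ x :=
    (slopeCovector (κ x)).hasFDerivAt.comp x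
      (hB.hasFDerivAt.clm_apply (hasFDerivAt_const (slopeCovector (κ x)) x))
  have hright := ((hasDerivAt_inv (hαpos x).ne').comp_hasFDerivAt x hα.hasFDerivAt).fun_add
    (hα.hasFDerivAt.fun_mul ((hκ.hasFDerivAt.const_sub (κ x)).pow 2))
  have heq := DFunLike.congr_fun (hleft.unique (funext hform ▸ hright)) w
  simpa [div_eq_inv_mul] using heq

theorem fderiv_localSimple_twistedMetric_slopeCovector (hU : IsOpen U) (hA : IsCometricOn A U)
    (hh : ContDiffOn ℝ ∞ h U) (hκ : ContDiffOn ℝ ∞ κ U) (hα : ContDiffOn ℝ ∞ α U)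
    (hαpos : ∀ x, 0 < α x) (hv : ContDiffOn ℝ ∞ v U) {x : E2} (hx : x ∈ U)
    (hmatch : MatchingConditions A h κ α v x) (r : ℝ) :
    fderiv ℝ (localSimple (fun x => (twistedMetric (α x) (κ x)).inverse) v)
      (x, r • slopeCovector (κ x))
      (stdHamiltonianVF (localSimple A h) (x, r • slopeCovector (κ x))) = 0 := by
  have hB := (isMetricOn_twistedMetric hα hαpos hκ).isCometricOn_inverse
  have hB' := hB.differentiableAt hU hx
  have hαx := hαpos x
  have hkinetic := hmatch.kinetic
  have hpotential := hmatch.potential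
  rw [fderiv_localSimple hB' (hB.symm x hx) (differentiableAt_of_contDiffOn hU hv hx),
    stdHamiltonianVF_localSimple (hA.differentiableAt hU hx) (hA.symm x hx)
      (differentiableAt_of_contDiffOn hU hh hx)]
  simp only [ContinuousLinearMap.map_smul, smul_apply, smul_eq_mul,
    fderiv_twistedMetric_inverse_slopeCovector (differentiableAt_of_contDiffOn hU hα hx) hαpos
      (differentiableAt_of_contDiffOn hU hκ hx) hB',
    twistedMetric_inverse_slopeCovector hαx]
  rw [hkinetic]
  simp only [neg_apply, add_apply, smul_apply, ContinuousLinearMap.comp_apply,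
    ContinuousLinearMap.flip_apply, ContinuousLinearMap.map_smul, smul_eq_mul, ← hpotential]
  field_simp
  ring

theorem fderiv_localSimple_twistedMetric_vertical (hU : IsOpen U) (hκ : ContDiffOn ℝ ∞ κ U)
    (hα : ContDiffOn ℝ ∞ α U) (hαpos : ∀ x, 0 < α x) (hv : ContDiffOn ℝ ∞ v U)
    {z : E2 × E2Dual} (hz : z.1 ∈ U) :
    fderiv ℝ (localSimple (fun x => (twistedMetric (α x) (κ x)).inverse) v) z (0, 𝐝₁) =
      α z.1 * (z.2 (EuclideanSpace.single 1 1) - κ z.1 * z.2 𝐞₀) := by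
  have hB := (isMetricOn_twistedMetric hα hαpos hκ).isCometricOn_inverse
  rw [fderiv_localSimple (hB.differentiableAt hU hz) (hB.symm _ hz)
      (differentiableAt_of_contDiffOn hU hv hz), ContinuousLinearMap.map_zero,
    twistedMetric_inverse_apply (hαpos _)]
  simp

theorem exists_feedback_of_matchingConditions (hU : IsOpen U) (h0 : 0 ∈ U)
    (hA : IsCometricOn A U) (hh : ContDiffOn ℝ ∞ h U) (hcrit : fderiv ℝ h 0 = 0)
    (hκ : ContDiffOn ℝ ∞ κ U) (hα : ContDiffOn ℝ ∞ α U) (hαpos : ∀ x, 0 < α x)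
    (hv : ContDiffOn ℝ ∞ v U) (hvcrit : fderiv ℝ v 0 = 0)
    (hmatch : ∀ x ∈ U, MatchingConditions A h κ α v x) :
    ∃ u : E2 × E2Dual → ℝ, ContDiffOn ℝ ∞ u (U ×ˢ univ) ∧ u 0 = 0 ∧ ∀ z ∈ U ×ˢ univ,
      fderiv ℝ (localSimple (fun x => (twistedMetric (α x) (κ x)).inverse) v) z
        (stdHamiltonianVF (localSimple A h) z + u z • (0, 𝐝₁)) = 0 := by
  have hB := (isMetricOn_twistedMetric hα hαpos hκ).isCometricOn_inverse
  let τ (z : E2 × E2Dual) : ℝ := z.2 (EuclideanSpace.single 1 1) - κ z.1 * z.2 𝐞₀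
  have hτ : ContDiffOn ℝ ∞ τ (U ×ˢ univ) :=
    (contDiffOn_snd.clm_apply contDiffOn_const).sub
      ((contDiffOn_comp_fst hκ).mul (contDiffOn_snd.clm_apply contDiffOn_const))
  have hshift (z : E2 × E2Dual) : z - τ z • (0, 𝐝₁) = (z.1, z.2 𝐞₀ • slopeCovector (κ z.1)) := by
    refine Prod.ext (by simp) ?_
    conv_lhs => rw [Prod.snd_sub, covector_eq z.2]
    ext w
    simp [τ, slopeCovector]
    ring
  have hinvariant : ∀ z ∈ U ×ˢ (univ : Set E2Dual), ∀ r : ℝ, z + r • (0, 𝐝₁) ∈ U ×ˢ univ :=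
    fun z hz r => ⟨by simpa using hz.1, mem_univ _⟩
  refine exists_feedback (hU.prod isOpen_univ) hinvariant
    (contDiffOn_localSimple hB.smooth hv)
    (contDiffOn_stdHamiltonianVF (hU.prod isOpen_univ) (contDiffOn_localSimple hA.smooth hh)) hτ
    (contDiffOn_comp_fst hα) (fun z _ => (hαpos z.1).ne')
    (fun z hz => fderiv_localSimple_twistedMetric_vertical hU hκ hα hαpos hv hz.1)
    (fun z hz => ?_) ?_ ?_ (stdHamiltonianVF_eq_zero ?_)
  · rw [hshift]
    exact fderiv_localSimple_twistedMetric_slopeCovector hU hA hh hκ hα hαpos hv hz.1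
      (hmatch _ hz.1) _
  · exact mk_mem_prod h0 (mem_univ (0 : E2Dual))
  · exact fderiv_localSimple_eq_zero (hB.differentiableAt hU h0) (hB.symm 0 h0)
      (differentiableAt_of_contDiffOn hU hv h0) hvcrit
  · exact fderiv_localSimple_eq_zero (hA.differentiableAt hU h0) (hA.symm 0 h0)
      (differentiableAt_of_contDiffOn hU hh h0) hcrit

end MatchedFeedback

theorem exists_localSimple_feedback {A : E2 → E2Dual →L[ℝ] E2} {Ω : Set E2} (hΩ : IsOpen Ω)
    (h0 : 0 ∈ Ω) (hA : IsCometricOn A Ω) {h : E2 → ℝ} (hh : ContDiffOn ℝ ∞ h Ω)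
    (hcrit : fderiv ℝ h 0 = 0)
    (hpos : A 0 𝐝₁ 0 * partialDeriv 0 (partialDeriv 0 h) 0 +
        A 0 𝐝₁ 1 * partialDeriv 1 (partialDeriv 0 h) 0 ≠ 0 ∨
      0 < partialDeriv 0 (partialDeriv 0 h) 0) :
    ∃ (U : Set E2) (G : E2 → E2 →L[ℝ] E2 →L[ℝ] ℝ) (v : E2 → ℝ) (u : E2 × E2Dual → ℝ),
      IsOpen U ∧ 0 ∈ U ∧ U ⊆ Ω ∧ IsMetricOn G U ∧ ContDiffOn ℝ ∞ v U ∧ v 0 = 0 ∧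
      (∀ x ∈ U, x ≠ 0 → 0 < v x) ∧ ContDiffOn ℝ ∞ u (U ×ˢ univ) ∧ u 0 = 0 ∧
      ∀ z ∈ U ×ˢ univ, fderiv ℝ (localSimple (fun x => (G x).inverse) v) z
        (stdHamiltonianVF (localSimple A h) z + u z • (0, 𝐝₁)) = 0 := by
  obtain ⟨U, κ, α, v, hU, h0U, hUΩ, hκ, hα, hαpos, hv, hv0, hvpos, hmatch⟩ :=
    exists_matchingConditions hΩ h0 hA hh hcrit hpos
  have hmin : IsLocalMin v 0 := by
    filter_upwards [hU.mem_nhds h0U] with x hx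
    rcases eq_or_ne x 0 with rfl | hx0
    exacts [le_rfl, hv0.trans_le (hvpos x hx hx0).le]
  have hAU : IsCometricOn A U :=
    ⟨fun x hx => hA.symm x (hUΩ hx), fun x hx => hA.pos x (hUΩ hx), hA.smooth.mono hUΩ⟩
  obtain ⟨u, hu, hu0, hfeedback⟩ := exists_feedback_of_matchingConditions hU h0U hAU
    (hh.mono hUΩ) hcrit hκ hα.contDiffOn hαpos hv.contDiffOn hmin.fderiv_eq_zero hmatch
  exact ⟨U, _, v, u, hU, h0U, hUΩ, isMetricOn_twistedMetric hα.contDiffOn hαpos hκ,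
    hv.contDiffOn, hv0, hvpos, hu, hu0, hfeedback⟩

section Lyapunov

variable {E : Type*} [NormedAddCommGroup E] [NormedSpace ℝ E]

theorem isMIntegralCurveOn_iff_isIntegralCurveOn {γ : ℝ → E} {X : E → E} {S : Set ℝ} :
    IsMIntegralCurveOn (I := 𝓘(ℝ, E)) γ X S ↔ IsIntegralCurveOn γ (fun _ => X) S :=
  forall₂_congr fun _ _ => hasMFDerivWithinAt_iff_hasFDerivWithinAt

theorem exists_isIntegralCurve_of_hasCompactSupport [CompleteSpace E] {X : E → E}
    (hX : ContDiff ℝ 1 X) (hc : HasCompactSupport X) (x : E) :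
    ∃ γ : ℝ → E, γ 0 = x ∧ IsIntegralCurve γ (fun _ => X) := by
  obtain ⟨K, hK⟩ := hX.lipschitzWith_of_hasCompactSupport hc one_ne_zero
  obtain ⟨L, hL⟩ := hc.exists_bound_of_continuous hX.continuous
  have hL0 : 0 ≤ L := (norm_nonneg _).trans (hL x)
  have hPL (y : E) : IsPicardLindelof (fun _ : ℝ => X) (tmin := -1) (tmax := 1)
      ⟨0, by norm_num, by norm_num⟩ y L.toNNReal 0 L.toNNReal K :=
    { lipschitzOnWith := fun _ _ => hK.lipschitzOnWith
      continuousOn := fun _ _ => continuousOn_const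
      norm_le := fun _ _ z _ => by simpa [Real.coe_toNNReal _ hL0] using hL z
      mul_max_le := by simp }
  obtain ⟨γ, hγ0, hγ⟩ := exists_isMIntegralCurve_of_isMIntegralCurveOn (I := 𝓘(ℝ, E))
    (contMDiff_vectorSpace_iff_contDiff.2 hX) one_pos (fun y => by
      obtain ⟨γ, hγ0, hγ⟩ := (hPL y).exists_eq_forall_mem_Icc_hasDerivWithinAt₀
      exact ⟨γ, hγ0, isMIntegralCurveOn_iff_isIntegralCurveOn.2 fun t ht =>
        (hγ t (Ioo_subset_Icc_self ht)).mono Ioo_subset_Icc_self⟩) x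
  refine ⟨γ, hγ0, isIntegralCurveOn_univ.1 ?_⟩
  exact isMIntegralCurveOn_iff_isIntegralCurveOn.1 (hγ.isMIntegralCurveOn univ)

theorem exists_first_eq {f : ℝ → ℝ} {a b r : ℝ} (hab : a ≤ b) (hf : ContinuousOn f (Icc a b))
    (ha : f a < r) (hb : r ≤ f b) : ∃ t ∈ Icc a b, f t = r ∧ ∀ s ∈ Ico a t, f s < r := by
  obtain ⟨c, hc, hfc⟩ := intermediate_value_Icc hab hf ⟨ha.le, hb⟩
  have hcompact : IsCompact (Icc a b ∩ f ⁻¹' {r}) :=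
    isCompact_Icc.of_isClosed_subset (hf.preimage_isClosed_of_isClosed isClosed_Icc
      isClosed_singleton) inter_subset_left
  obtain ⟨t, ⟨ht, hft⟩, hleast⟩ := hcompact.exists_isLeast ⟨c, hc, hfc⟩
  refine ⟨t, ht, hft, fun s hs => ?_⟩
  by_contra! hrs
  have hsb : s ≤ b := hs.2.le.trans ht.2
  obtain ⟨s', hs', hfs'⟩ := intermediate_value_Icc hs.1 (hf.mono (Icc_subset_Icc_right hsb))
    ⟨ha.le, hrs⟩
  exact (hleast ⟨⟨hs'.1, hs'.2.trans hsb⟩, hfs'⟩).not_gt (hs'.2.trans_lt hs.2)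

theorem antitoneOn_comp_of_fderiv_nonpos {X : E → E} {V : E → ℝ} {D : Set E} (hD : IsOpen D)
    (hV : DifferentiableOn ℝ V D) (hdec : ∀ z ∈ D, fderiv ℝ V z (X z) ≤ 0) {γ : ℝ → E} {a b : ℝ}
    (hγ : ContinuousOn γ (Icc a b)) (hγD : MapsTo γ (Icc a b) D)
    (hγX : IsIntegralCurveOn γ (fun _ => X) (Ioo a b)) : AntitoneOn (V ∘ γ) (Icc a b) := by
  refine antitoneOn_of_hasDerivWithinAt_nonpos (convex_Icc a b)
    (f' := fun t => fderiv ℝ V (γ t) (X (γ t))) (hV.continuousOn.comp hγ hγD) ?_ ?_ <;>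
    rw [interior_Icc] <;> intro t ht
  · have hVt := hV.differentiableAt (hD.mem_nhds (hγD (Ioo_subset_Icc_self ht)))
    exact hVt.hasFDerivAt.comp_hasDerivWithinAt t (hγX t ht)
  · exact hdec _ (hγD (Ioo_subset_Icc_self ht))

theorem mem_ball_of_lyapunov {X : E → E} {V : E → ℝ} {D : Set E} (hD : IsOpen D)
    (hV : DifferentiableOn ℝ V D) (hdec : ∀ z ∈ D, fderiv ℝ V z (X z) ≤ 0) {x₀ : E} {r m : ℝ}
    (hball : Metric.closedBall x₀ r ⊆ D) (hm : ∀ z ∈ Metric.sphere x₀ r, m ≤ V z)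
    {γ : ℝ → E} {T : ℝ} (hT : 0 ≤ T) (hγ : ContinuousOn γ (Icc 0 T))
    (hγX : ∀ t ∈ Icc 0 T, γ t ∈ Metric.ball x₀ r → HasDerivWithinAt γ (X (γ t)) (Icc 0 T) t)
    (hγ0 : γ 0 ∈ Metric.ball x₀ r) (hVγ0 : V (γ 0) < m) : γ T ∈ Metric.ball x₀ r := by
  by_contra hγT
  obtain ⟨t, ht, htr, hlt⟩ := exists_first_eq hT (f := fun t => dist (γ t) x₀)
    (continuous_id.dist continuous_const |>.comp_continuousOn hγ) hγ0 (not_lt.1 hγT)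
  have hsub : Icc 0 t ⊆ Icc 0 T := Icc_subset_Icc_right ht.2
  have hγD : MapsTo γ (Icc 0 t) D := fun s hs => hball <| by
    rcases hs.2.eq_or_lt with rfl | hst
    exacts [htr.le, (hlt s ⟨hs.1, hst⟩).le]
  have hanti := antitoneOn_comp_of_fderiv_nonpos hD hV hdec (hγ.mono hsub) hγD fun s hs =>
    (hγX s (hsub (Ioo_subset_Icc_self hs)) (hlt s ⟨hs.1.le, hs.2⟩)).mono
      (Ioo_subset_Icc_self.trans hsub)
  exact (hanti (left_mem_Icc.2 ht.1) (right_mem_Icc.2 ht.1) ht.1).not_gt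
    (hVγ0.trans_le (hm (γ t) htr))

/- A trajectory starting in the ball where `V < min V` on the bounding sphere cannot leave that
ball; it is global because `X` agrees there with a compactly supported field. -/
theorem isStableAt_of_lyapunov [FiniteDimensional ℝ E] {X : E → E} {V : E → ℝ} {D : Set E}
    (hD : IsOpen D) {x₀ : E} (hx₀ : x₀ ∈ D) (hX : ContDiffOn ℝ 1 X D) (hXx₀ : X x₀ = 0)
    (hV : DifferentiableOn ℝ V D) (hVx₀ : V x₀ = 0) (hpos : ∀ z ∈ D, z ≠ x₀ → 0 < V z)
    (hdec : ∀ z ∈ D, fderiv ℝ V z (X z) ≤ 0) : IsStableAt 𝓘(ℝ, E) X D x₀ := by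
  refine ⟨hx₀, hXx₀, fun N hN => ?_⟩
  obtain ⟨X', hX', hX'c, hX'X⟩ := exists_contDiff_eventuallyEq (n := 1) (hD.mem_nhds hx₀) hX
  obtain ⟨r, hr, hsub⟩ := Metric.nhds_basis_closedBall.mem_iff.1
    (inter_mem (inter_mem hN (hD.mem_nhds hx₀)) hX'X)
  have hrD : Metric.closedBall x₀ r ⊆ D := fun z hz => (hsub hz).1.2
  obtain ⟨m, hm0, hm⟩ := (isCompact_sphere x₀ r).exists_forall_le'
    (hV.continuousOn.mono (Metric.sphere_subset_closedBall.trans hrD)) fun z hz =>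
      hpos z (hrD (Metric.sphere_subset_closedBall hz)) (Metric.ne_of_mem_sphere hz hr.ne')
  have hVm : ∀ᶠ z in 𝓝 x₀, V z < m :=
    (hV.continuousOn.continuousAt (hD.mem_nhds hx₀)).eventually_lt continuousAt_const
      (by rwa [hVx₀])
  refine ⟨Metric.ball x₀ r ∩ {z | V z < m}, inter_mem (Metric.ball_mem_nhds _ hr) hVm, ?_⟩
  rintro z ⟨hzr, hzm⟩
  constructor
  · obtain ⟨γ, rfl, hγ⟩ := exists_isIntegralCurve_of_hasCompactSupport hX' hX'c z
    have hγr (t : ℝ) (ht : 0 ≤ t) : γ t ∈ Metric.closedBall x₀ r :=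
      Metric.ball_subset_closedBall <| mem_ball_of_lyapunov hD hV hdec hrD hm ht
        (fun s _ => (hγ s).continuousAt.continuousWithinAt) (fun s _ hs => by
          rw [← (hsub (Metric.ball_subset_closedBall hs)).2]; exact (hγ s).hasDerivWithinAt)
        hzr hzm
    refine ⟨γ, rfl, fun t ht => hrD (hγr t ht), ?_⟩
    refine isMIntegralCurveOn_iff_isIntegralCurveOn.2 fun t ht => ?_
    have hX'Xt : X' (γ t) = X (γ t) := (hsub (hγr t ht)).2
    simpa only [hX'Xt] using (hγ t).hasDerivWithinAt (s := Ici 0)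
  · rintro γ τ rfl - hγ t ht
    have hγX := (isMIntegralCurveOn_iff_isIntegralCurveOn.1 hγ).mono (Icc_subset_Ico_right ht.2)
    have hγt := mem_ball_of_lyapunov hD hV hdec hrD hm ht.1 hγX.continuousOn
      (fun s hs _ => hγX s hs) hzr hzm
    exact (hsub (Metric.ball_subset_closedBall hγt)).1.1

end Lyapunov

section Transport

variable {F F' : Type*} [NormedAddCommGroup F] [NormedSpace ℝ F] [NormedAddCommGroup F']
  [NormedSpace ℝ F'] {K K' : Type*} [TopologicalSpace K] [TopologicalSpace K']
  {J : ModelWithCorners ℝ F K} {J' : ModelWithCorners ℝ F' K'} {P P' : Type*}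
  [TopologicalSpace P] [ChartedSpace K P] [TopologicalSpace P'] [ChartedSpace K' P']

theorem isMIntegralCurveOn_comp {X : ∀ α : P, TangentSpace J α} {X' : ∀ α : P', TangentSpace J' α}
    {f : P → P'} {γ : ℝ → P} {S : Set ℝ} (hf : ∀ t ∈ S, MDifferentiableAt J J' f (γ t))
    (hfX : ∀ t ∈ S, mfderiv J J' f (γ t) (X (γ t)) = X' (f (γ t)))
    (hγ : IsMIntegralCurveOn γ X S) : IsMIntegralCurveOn (f ∘ γ) X' S := fun t ht => by
  refine ((hf t ht).hasMFDerivAt.comp_hasMFDerivWithinAt t (hγ t ht)).congr_mfderiv ?_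
  refine ContinuousLinearMap.ext fun (r : ℝ) => ?_
  refine ((mfderiv J J' f (γ t)).map_smul r (X (γ t))).trans ?_
  exact congrArg (r • ·) (hfX t ht)

theorem isStableAt_of_isStableAt_image {Φ : OpenPartialHomeomorph P P'}
    (hΦ : Φ.MDifferentiable J J')
    {X : ∀ α : P, TangentSpace J α} {X' : ∀ α : P', TangentSpace J' α} {D : Set P}
    (hDΦ : D ⊆ Φ.source) (hX : ∀ α ∈ D, mfderiv J J' Φ α (X α) = X' (Φ α)) {α₀ : P} (hα₀ : α₀ ∈ D)
    (hstable : IsStableAt J' X' (Φ '' D) (Φ α₀)) : IsStableAt J X D α₀ := by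
  obtain ⟨-, hX'α₀, hnhds⟩ := hstable
  have hΦX (α : P) (hα : α ∈ D) : mfderiv J' J Φ.symm (Φ α) (X' (Φ α)) = X α := by
    rw [← hX α hα, ← ContinuousLinearMap.comp_apply, hΦ.symm_comp_deriv (hDΦ hα)]
    rfl
  have hXα₀ : X α₀ = 0 := by
    rw [← hΦX α₀ hα₀, hX'α₀]
    exact (mfderiv J' J Φ.symm (Φ α₀)).map_zero
  refine ⟨hα₀, hXα₀, fun N hN => ?_⟩
  have hΦα₀ := hDΦ hα₀
  obtain ⟨N', hN', hN'N⟩ := hnhds (Φ.symm ⁻¹' N)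
    ((Φ.symm.continuousAt (Φ.map_source hΦα₀)).preimage_mem_nhds (by rwa [Φ.left_inv hΦα₀]))
  refine ⟨Φ.source ∩ Φ ⁻¹' N', inter_mem (Φ.open_source.mem_nhds hΦα₀)
    ((Φ.continuousAt hΦα₀).preimage_mem_nhds hN'), ?_⟩
  rintro α ⟨hα, hαN'⟩
  obtain ⟨⟨Γ', hΓ'0, hΓ'D, hΓ'X⟩, hstay⟩ := hN'N (Φ α) hαN'
  have hsymm {β : P'} (hβ : β ∈ Φ '' D) : β ∈ Φ.target ∧ Φ.symm β ∈ D ∧ Φ (Φ.symm β) = β := by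
    obtain ⟨α, hα, rfl⟩ := hβ
    rw [Φ.left_inv (hDΦ hα)]
    exact ⟨Φ.map_source (hDΦ hα), hα, rfl⟩
  constructor
  · refine ⟨Φ.symm ∘ Γ', by simp [hΓ'0, Φ.left_inv hα], fun t ht => (hsymm (hΓ'D t ht)).2.1,
      isMIntegralCurveOn_comp (fun t ht => hΦ.mdifferentiableAt_symm (hsymm (hΓ'D t ht)).1)
        (fun t ht => ?_) hΓ'X⟩
    obtain ⟨-, hD, hΦΓ'⟩ := hsymm (hΓ'D t ht)
    have hΦXt := hΦX _ hD
    rwa [hΦΓ'] at hΦXt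
  · intro Γ τ hΓ0 hΓD hΓX t ht
    have hΦΓ := hstay (Φ ∘ Γ) τ (by simp [hΓ0]) (fun s hs => mem_image_of_mem Φ (hΓD s hs))
      (isMIntegralCurveOn_comp (fun s hs => hΦ.mdifferentiableAt (hDΦ (hΓD s hs)))
        (fun s hs => hX _ (hΓD s hs)) hΓX) t ht
    simpa [Φ.left_inv (hDΦ (hΓD t ht))] using hΦΓ

theorem IsLyapunovOn.isStableAt [FiniteDimensional ℝ F'] {Φ : OpenPartialHomeomorph P F'}
    (hΦ : Φ.MDifferentiable J 𝓘(ℝ, F')) {D : Set P} (hD : IsOpen D) (hDΦ : D ⊆ Φ.source)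
    {X : ∀ α : P, TangentSpace J α} {X' : F' → F'}
    (hX : ∀ α ∈ D, mfderiv J 𝓘(ℝ, F') Φ α (X α) = X' (Φ α)) (hX' : ContDiffOn ℝ 1 X' (Φ '' D))
    {V : P → ℝ} {α₀ : P} (hV : IsLyapunovOn J X V D α₀) : IsStableAt J X D α₀ := by
  have hX'α₀ : X' (Φ α₀) = 0 := by
    rw [← hX α₀ hV.mem, hV.critical]
    exact (mfderiv J 𝓘(ℝ, F') Φ α₀).map_zero
  have hVΦ (α : P) (hα : α ∈ D) : ∃ V' : F' →L[ℝ] ℝ, HasFDerivAt (V ∘ Φ.symm) V' (Φ α) ∧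
      V' (X' (Φ α)) = derivAlong J V X α := by
    have hVα := ((hV.smooth.contMDiffAt (hD.mem_nhds hα)).mdifferentiableAt (by simp)).hasMFDerivAt
    have hsymm := (hΦ.mdifferentiableAt_symm (Φ.map_source (hDΦ hα))).hasMFDerivAt
    rw [← Φ.left_inv (hDΦ hα)] at hVα
    have hcomp := hVα.comp (Φ α) hsymm
    rw [Φ.left_inv (hDΦ hα)] at hcomp
    refine ⟨_, hasMFDerivAt_iff_hasFDerivAt.1 hcomp, ?_⟩
    rw [← hX α hα]
    exact congrArg (mfderiv J 𝓘(ℝ, ℝ) V α)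
      (DFunLike.congr_fun (hΦ.symm_comp_deriv (hDΦ hα)) (X α))
  refine isStableAt_of_isStableAt_image hΦ hDΦ hX hV.mem (isStableAt_of_lyapunov
    (V := V ∘ Φ.symm) (Φ.isOpen_image_of_subset_source hD hDΦ) (mem_image_of_mem Φ hV.mem) hX'
    hX'α₀ ?_ ?_ ?_ ?_)
  · rintro _ ⟨α, hα, rfl⟩
    obtain ⟨V', hV', -⟩ := hVΦ α hα
    exact hV'.differentiableAt.differentiableWithinAt
  · simp [Φ.left_inv (hDΦ hV.mem), hV.zero]
  · rintro _ ⟨α, hα, rfl⟩ hne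
    simpa [Φ.left_inv (hDΦ hα)] using hV.pos α hα fun h => hne (congrArg Φ h)
  · rintro _ ⟨α, hα, rfl⟩
    obtain ⟨V', hV', hV'X⟩ := hVΦ α hα
    exact hV'.fderiv.symm ▸ hV'X.trans_le (hV.decreasing α hα)

end Transport

section CotangentMap

variable {E F : Type*} [NormedAddCommGroup E] [NormedSpace ℝ E] [NormedAddCommGroup F]
  [NormedSpace ℝ F]

/-- The cotangent lift `(q, p) ↦ (τ q, p ∘ dσ(τ q))` of a local diffeomorphism `τ` between open
subsets of normed spaces; its local inverse `σ` is passed as an argument of its own. -/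
noncomputable def cotangentMap (τ : E → F) (σ : F → E) (z : E × (E →L[ℝ] ℝ)) :
    F × (F →L[ℝ] ℝ) :=
  (τ z.1, z.2.comp (fderiv ℝ σ (τ z.1)))

variable {τ : E → F} {σ : F → E} {z : E × (E →L[ℝ] ℝ)}

theorem contDiffAt_cotangentMap (hτ : ContDiffAt ℝ ∞ τ z.1) (hσ : ContDiffAt ℝ ∞ σ (τ z.1)) :
    ContDiffAt ℝ ∞ (cotangentMap τ σ) z := by
  have hbase : ContDiffAt ℝ ∞ (fun w : E × (E →L[ℝ] ℝ) => τ w.1) z := hτ.comp z contDiffAt_fst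
  have hderiv : ContDiffAt ℝ ∞ (fderiv ℝ σ) (τ z.1) := hσ.fderiv_right (by simp)
  exact hbase.prodMk (contDiffAt_snd.clm_comp (hderiv.comp z hbase))

theorem cotangentMap_snd_comp_fderiv (hτ : DifferentiableAt ℝ τ z.1)
    (hσ : DifferentiableAt ℝ σ (τ z.1)) (hστ : σ ∘ τ =ᶠ[𝓝 z.1] id) :
    (cotangentMap τ σ z).2.comp (fderiv ℝ τ z.1) = z.2 := by
  have hid : (fderiv ℝ σ (τ z.1)).comp (fderiv ℝ τ z.1) = ContinuousLinearMap.id ℝ E := by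
    rw [← fderiv_comp z.1 hσ hτ, hστ.fderiv_eq, fderiv_id]
  rw [cotangentMap, ContinuousLinearMap.comp_assoc, hid, ContinuousLinearMap.comp_id]

theorem fderiv_cotangentMap_fst (hτ : ContDiffAt ℝ ∞ τ z.1) (hσ : ContDiffAt ℝ ∞ σ (τ z.1))
    (u : E × (E →L[ℝ] ℝ)) : (fderiv ℝ (cotangentMap τ σ) z u).1 = fderiv ℝ τ z.1 u.1 := by
  have hT := ((contDiffAt_cotangentMap hτ hσ).differentiableAt (by simp)).hasFDerivAt
  have hbase : HasFDerivAt (fun w : E × (E →L[ℝ] ℝ) => τ w.1) _ z :=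
    (hτ.differentiableAt (by simp)).hasFDerivAt.comp z hasFDerivAt_fst
  exact DFunLike.congr_fun (hT.fst.unique hbase) u

theorem snd_apply_eq_fderiv_cotangentMap (hτ : ContDiffAt ℝ ∞ τ z.1)
    (hσ : ContDiffAt ℝ ∞ σ (τ z.1)) (hστ : σ ∘ τ =ᶠ[𝓝 z.1] id) (u : E × (E →L[ℝ] ℝ)) (v : E) :
    u.2 v = (cotangentMap τ σ z).2 (fderiv ℝ (fderiv ℝ τ) z.1 u.1 v) +
      (fderiv ℝ (cotangentMap τ σ) z u).2 (fderiv ℝ τ z.1 v) := by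
  have hT := ((contDiffAt_cotangentMap hτ hσ).differentiableAt (by simp)).hasFDerivAt
  have hdτ : HasFDerivAt (fun w : E × (E →L[ℝ] ℝ) => fderiv ℝ τ w.1) _ z :=
    ((hτ.fderiv_right (m := ∞) (by simp)).differentiableAt (by simp)).hasFDerivAt.comp z
      hasFDerivAt_fst
  have hτ_near : ∀ᶠ x in 𝓝 z.1, ContDiffAt ℝ 1 τ x :=
    (hτ.of_le (by simp)).eventually (by simp)
  have hσ_near : ∀ᶠ x in 𝓝 z.1, ContDiffAt ℝ 1 σ (τ x) :=
    hτ.continuousAt.eventually ((hσ.of_le (by simp)).eventually (by simp))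
  have hpull : (fun w => (cotangentMap τ σ w).2.comp (fderiv ℝ τ w.1)) =ᶠ[𝓝 z] Prod.snd := by
    filter_upwards [continuous_fst.continuousAt.eventually
      (hτ_near.and (hσ_near.and hστ.eventuallyEq_nhds))] with w ⟨hτw, hσw, hστw⟩
    exact cotangentMap_snd_comp_fderiv (hτw.differentiableAt one_ne_zero)
      (hσw.differentiableAt one_ne_zero) hστw
  have hsnd : HasFDerivAt (fun w : E × (E →L[ℝ] ℝ) => w.2) _ z := hasFDerivAt_snd (𝕜 := ℝ)
  have hderiv := hsnd.unique ((hT.snd.clm_comp hdτ).congr_of_eventuallyEq hpull.symm)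
  simpa using DFunLike.congr_fun (DFunLike.congr_fun hderiv u) v

end CotangentMap

theorem stdSymplectic_fderiv_cotangentMap {τ σ : E2 → E2} {z : E2 × E2Dual}
    (hτ : ContDiffAt ℝ ∞ τ z.1) (hσ : ContDiffAt ℝ ∞ σ (τ z.1)) (hστ : σ ∘ τ =ᶠ[𝓝 z.1] id)
    (x y : E2 × E2Dual) :
    stdSymplectic (fderiv ℝ (cotangentMap τ σ) z x) (fderiv ℝ (cotangentMap τ σ) z y) =
      stdSymplectic x y := by
  have hsymm := (hτ.isSymmSndFDerivAt (by simpa using ENat.LEInfty.out)).eq x.1 y.1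
  rw [stdSymplectic_apply, stdSymplectic_apply, fderiv_cotangentMap_fst hτ hσ,
    fderiv_cotangentMap_fst hτ hσ, snd_apply_eq_fderiv_cotangentMap hτ hσ hστ x,
    snd_apply_eq_fderiv_cotangentMap hτ hσ hστ y, hsymm]
  ring

theorem transition_comp_transition_eventuallyEq {X Y Z : Type*} [TopologicalSpace X]
    [TopologicalSpace Y] [TopologicalSpace Z] {φ : OpenPartialHomeomorph X Y}
    {ψ : OpenPartialHomeomorph X Z} {q : X} (hqφ : q ∈ φ.source)
    (hqψ : q ∈ ψ.source) : (φ ∘ ψ.symm) ∘ (ψ ∘ φ.symm) =ᶠ[𝓝 (φ q)] id := by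
  have hψ_near : ∀ᶠ x in 𝓝 (φ q), φ.symm x ∈ ψ.source :=
    (φ.continuousAt_symm (φ.map_source hqφ)).eventually
      (ψ.open_source.mem_nhds (by rwa [φ.left_inv hqφ]))
  filter_upwards [φ.open_target.mem_nhds (φ.map_source hqφ), hψ_near] with x hxφ hxψ
  simp only [Function.comp_apply, ψ.left_inv hxψ, φ.right_inv hxφ, id]

section Charts

variable {Q : Type*} [TopologicalSpace Q] [ChartedSpace E2 Q] {φ ψ : OpenPartialHomeomorph Q E2}

theorem mdifferentiable_chart (hφ : φ ∈ IsManifold.maximalAtlas (𝓡 2) ∞ Q) :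
    φ.MDifferentiable (𝓡 2) 𝓘(ℝ, E2) :=
  ⟨fun _ hq => ((contMDiffAt_of_mem_maximalAtlas hφ hq).mdifferentiableAt
      (by simp)).mdifferentiableWithinAt,
    fun _ hz => ((contMDiffAt_symm_of_mem_maximalAtlas hφ hz).mdifferentiableAt
      (by simp)).mdifferentiableWithinAt⟩

theorem contDiffAt_transition (hφ : φ ∈ IsManifold.maximalAtlas (𝓡 2) ∞ Q)
    (hψ : ψ ∈ IsManifold.maximalAtlas (𝓡 2) ∞ Q) {q : Q} (hqφ : q ∈ φ.source)
    (hqψ : q ∈ ψ.source) : ContDiffAt ℝ ∞ (φ ∘ ψ.symm) (ψ q) :=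
  contMDiffAt_iff_contDiffAt.1 ((contMDiffAt_of_mem_maximalAtlas hφ
    (by rwa [ψ.left_inv hqψ])).comp (ψ q)
      (contMDiffAt_symm_of_mem_maximalAtlas hψ (ψ.map_source hqψ)))

theorem isInvertible_chartDeriv (hφ : φ ∈ IsManifold.maximalAtlas (𝓡 2) ∞ Q) {q : Q}
    (hq : q ∈ φ.source) : (chartDeriv φ q).IsInvertible :=
  ⟨(mdifferentiable_chart hφ).mfderiv hq, rfl⟩

theorem fderiv_transition_comp_chartDeriv (hφ : φ ∈ IsManifold.maximalAtlas (𝓡 2) ∞ Q)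
    (hψ : ψ ∈ IsManifold.maximalAtlas (𝓡 2) ∞ Q) {q : Q} (hqφ : q ∈ φ.source)
    (hqψ : q ∈ ψ.source) :
    (fderiv ℝ (φ ∘ ψ.symm) (ψ q)).comp (chartDeriv ψ q) = chartDeriv φ q := by
  have htrans : MDifferentiableAt 𝓘(ℝ, E2) 𝓘(ℝ, E2) (φ ∘ ψ.symm) (ψ q) :=
    ((contDiffAt_transition hφ hψ hqφ hqψ).differentiableAt (by simp)).mdifferentiableAt
  have hchain := mfderiv_comp q htrans ((mdifferentiable_chart hψ).mdifferentiableAt hqψ)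
  rw [mfderiv_eq_fderiv] at hchain
  have hcomp : (φ ∘ ψ.symm) ∘ ψ =ᶠ[𝓝 q] φ := by
    filter_upwards [ψ.open_source.mem_nhds hqψ] with x hx
    rw [Function.comp_apply, Function.comp_apply, ψ.left_inv hx]
  exact hchain.symm.trans hcomp.mfderiv_eq

theorem chartDeriv_comp_inverse (hφ : φ ∈ IsManifold.maximalAtlas (𝓡 2) ∞ Q)
    (hψ : ψ ∈ IsManifold.maximalAtlas (𝓡 2) ∞ Q) {q : Q} (hqφ : q ∈ φ.source)
    (hqψ : q ∈ ψ.source) :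
    (chartDeriv φ q).comp (chartDeriv ψ q).inverse = fderiv ℝ (φ ∘ ψ.symm) (ψ q) := by
  rw [← fderiv_transition_comp_chartDeriv hφ hψ hqφ hqψ, ContinuousLinearMap.comp_assoc,
    (isInvertible_chartDeriv hψ hqψ).self_comp_inverse, ContinuousLinearMap.comp_id]

/-- The inverse `(q, p) ↦ (φ⁻¹ q, p ∘ dφ)` of the coordinates `cotangentCoord φ`. -/
noncomputable def cotangentLift (φ : OpenPartialHomeomorph Q E2) (z : E2 × E2Dual) :
    CotangentBundle Q :=
  ⟨φ.symm z.1, z.2.comp (chartDeriv φ (φ.symm z.1))⟩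

theorem cotangentCoord_lift (hφ : φ ∈ IsManifold.maximalAtlas (𝓡 2) ∞ Q) {z : E2 × E2Dual}
    (hz : z.1 ∈ φ.target) : cotangentCoord φ (cotangentLift φ z) = z := by
  refine Prod.ext (φ.right_inv hz) ?_
  change (z.2.comp (chartDeriv φ (φ.symm z.1))).comp (chartDeriv φ (φ.symm z.1)).inverse = z.2
  rw [ContinuousLinearMap.comp_assoc,
    (isInvertible_chartDeriv hφ (φ.map_target hz)).self_comp_inverse, ContinuousLinearMap.comp_id]

theorem cotangentLift_coord (hφ : φ ∈ IsManifold.maximalAtlas (𝓡 2) ∞ Q) {α : CotangentBundle Q}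
    (hα : α.proj ∈ φ.source) : cotangentLift φ (cotangentCoord φ α) = α := by
  obtain ⟨q, p⟩ := α
  change (⟨φ.symm (φ q), (p.comp (chartDeriv φ q).inverse).comp (chartDeriv φ (φ.symm (φ q)))⟩ :
    CotangentBundle Q) = ⟨q, p⟩
  rw [φ.left_inv hα, ContinuousLinearMap.comp_assoc,
    (isInvertible_chartDeriv hφ hα).inverse_comp_self]
  rfl

theorem cotangentCoord_nullPoint {q : Q} (hq : φ q = 0) :
    cotangentCoord φ (nullPoint q) = 0 :=
  Prod.ext hq (ContinuousLinearMap.zero_comp _)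

theorem cotangentCoord_eq_cotangentMap (hφ : φ ∈ IsManifold.maximalAtlas (𝓡 2) ∞ Q)
    (hψ : ψ ∈ IsManifold.maximalAtlas (𝓡 2) ∞ Q) {α : CotangentBundle Q}
    (hαφ : α.proj ∈ φ.source) (hαψ : α.proj ∈ ψ.source) :
    cotangentCoord φ α =
      cotangentMap (φ ∘ ψ.symm) (ψ ∘ φ.symm) (cotangentCoord ψ α) := by
  have hbase : (φ ∘ ψ.symm) (cotangentCoord ψ α).1 = φ α.proj :=
    congrArg φ (ψ.left_inv hαψ)
  refine Prod.ext hbase.symm ?_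
  rw [cotangentMap, hbase, ← chartDeriv_comp_inverse hψ hφ hαψ hαφ]
  ext v
  exact congrArg α.snd (DFunLike.congr_fun
    (isInvertible_chartDeriv hψ hαψ).inverse_comp_self ((chartDeriv φ α.proj).inverse v)).symm

variable [IsManifold (𝓡 2) ∞ Q]

theorem symmL_trivializationAt_eq_chartDeriv_inverse {q q₁ : Q}
    (hq : q ∈ (chartAt E2 q₁).source) :
    (trivializationAt E2 (TangentSpace (𝓡 2)) q₁).symmL ℝ q =
      (chartDeriv (chartAt E2 q₁) q).inverse := by
  have hchart := isInvertible_chartDeriv (IsManifold.chart_mem_maximalAtlas q₁) hq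
  have htriv : chartDeriv (chartAt E2 q₁) q =
      (trivializationAt E2 (TangentSpace (𝓡 2)) q₁).continuousLinearMapAt ℝ q :=
    (TangentBundle.continuousLinearMapAt_trivializationAt (I := 𝓡 2) hq).symm
  ext v : 1
  obtain ⟨u, rfl⟩ := hchart.surjective v
  rw [hchart.inverse_apply_self, htriv]
  exact (trivializationAt E2 (TangentSpace (𝓡 2)) q₁).symmL_continuousLinearMapAt
    (R := ℝ) (b := q) (by simpa using hq) u

theorem inCoordinates_covector_eq {q₁ : Q} {α : CotangentBundle Q}
    (hα : α.proj ∈ (chartAt E2 q₁).source) :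
    ContinuousLinearMap.inCoordinates E2 (TangentSpace (𝓡 2)) ℝ (Bundle.Trivial Q ℝ)
      q₁ α.proj q₁ α.proj α.snd = (cotangentCoord (chartAt E2 q₁) α).2 := by
  ext v
  simp [ContinuousLinearMap.inCoordinates, cotangentCoord,
    symmL_trivializationAt_eq_chartDeriv_inverse hα]

section Maps

variable {F M K : Type*} [NormedAddCommGroup F] [NormedSpace ℝ F] [TopologicalSpace K]
  {J : ModelWithCorners ℝ F K} [TopologicalSpace M] [ChartedSpace K M]

theorem contMDiffAt_cotangentBundle_iff {f : M → CotangentBundle Q} {x : M} :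
    ContMDiffAt J cotModel ∞ f x ↔ ContMDiffAt J (𝓡 2) ∞ (fun y => (f y).proj) x ∧
      ContMDiffAt J 𝓘(ℝ, E2Dual) ∞
        (fun y => (cotangentCoord (chartAt E2 (f x).proj) (f y)).2) x := by
  refine (contMDiffAt_hom_bundle f).trans (and_congr_right fun hbase => ?_)
  have hnear : ∀ᶠ y in 𝓝 x, (f y).proj ∈ (chartAt E2 (f x).proj).source :=
    hbase.continuousAt.eventually ((chartAt E2 (f x).proj).open_source.mem_nhds
      (mem_chart_source E2 _))
  exact Filter.EventuallyEq.contMDiffAt_iff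
    (hnear.mono fun y hy => inCoordinates_covector_eq hy)

end Maps

theorem eventually_proj_mem {α : CotangentBundle Q} {U : Set Q} (hU : IsOpen U)
    (hα : α.proj ∈ U) : ∀ᶠ β : CotangentBundle Q in 𝓝 α, β.proj ∈ U :=
  (FiberBundle.continuous_proj E2Dual
    (fun q : Q => TangentSpace (𝓡 2) q →L[ℝ] ℝ)).continuousAt.eventually (hU.mem_nhds hα)

theorem isOpen_cotangentOver {U : Set Q} (hU : IsOpen U) :
    IsOpen (cotangentOver U : Set (CotangentBundle Q)) :=
  isOpen_iff_mem_nhds.2 fun _ hα => eventually_proj_mem hU hα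

theorem contMDiffAt_cotangentCoord (hφ : φ ∈ IsManifold.maximalAtlas (𝓡 2) ∞ Q)
    {α : CotangentBundle Q} (hα : α.proj ∈ φ.source) :
    ContMDiffAt cotModel 𝓘(ℝ, E2 × E2Dual) ∞ (cotangentCoord φ) α := by
  have hψ := IsManifold.chart_mem_maximalAtlas (I := 𝓡 2) (n := ∞) α.proj
  have hαψ := mem_chart_source E2 α.proj
  obtain ⟨hproj, hmomentum⟩ := contMDiffAt_cotangentBundle_iff.1
    (contMDiffAt_id : ContMDiffAt cotModel cotModel ∞ (id : CotangentBundle Q → _) α)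
  have hcoord : ContMDiffAt cotModel 𝓘(ℝ, E2 × E2Dual) ∞
      (cotangentCoord (chartAt E2 α.proj)) α :=
    ((contMDiffAt_of_mem_maximalAtlas hψ hαψ).comp α hproj).prodMk_space hmomentum
  have hmap := contDiffAt_cotangentMap (z := cotangentCoord (chartAt E2 α.proj) α)
    (contDiffAt_transition hφ hψ hα hαψ) (σ := chartAt E2 α.proj ∘ φ.symm)
    (by simpa [cotangentCoord, hαψ] using contDiffAt_transition hψ hφ hαψ hα)
  refine (hmap.contMDiffAt.comp α hcoord).congr_of_eventuallyEq ?_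
  filter_upwards [eventually_proj_mem φ.open_source hα,
    eventually_proj_mem (chartAt E2 α.proj).open_source hαψ] with β hβφ hβψ
  exact cotangentCoord_eq_cotangentMap hφ hψ hβφ hβψ

theorem contMDiffAt_cotangentLift (hφ : φ ∈ IsManifold.maximalAtlas (𝓡 2) ∞ Q) {z : E2 × E2Dual}
    (hz : z.1 ∈ φ.target) :
    ContMDiffAt 𝓘(ℝ, E2 × E2Dual) cotModel ∞ (cotangentLift φ : _ → CotangentBundle Q) z := by
  have hψ := IsManifold.chart_mem_maximalAtlas (I := 𝓡 2) (n := ∞) (φ.symm z.1)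
  have hzφ := φ.map_target hz
  have hzψ := mem_chart_source E2 (φ.symm z.1)
  have hbase : ContMDiffAt 𝓘(ℝ, E2 × E2Dual) (𝓡 2) ∞ (fun w : E2 × E2Dual => φ.symm w.1) z :=
    (contMDiffAt_symm_of_mem_maximalAtlas hφ hz).comp z contDiff_fst.contMDiff.contMDiffAt
  refine contMDiffAt_cotangentBundle_iff.2 ⟨hbase, ?_⟩
  have hmap := contDiffAt_cotangentMap (z := z) (τ := chartAt E2 (φ.symm z.1) ∘ φ.symm)
    (by simpa [hz] using contDiffAt_transition hψ hφ hzψ hzφ)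
    (contDiffAt_transition hφ hψ hzφ hzψ)
  refine hmap.snd.contMDiffAt.congr_of_eventuallyEq ?_
  filter_upwards [continuous_fst.continuousAt.eventually (φ.open_target.mem_nhds hz),
    hbase.continuousAt.eventually ((chartAt E2 (φ.symm z.1)).open_source.mem_nhds hzψ)]
    with w hwφ hwψ
  change (cotangentCoord (chartAt E2 (φ.symm z.1)) (cotangentLift φ w)).2 = _
  rw [cotangentCoord_eq_cotangentMap (α := cotangentLift φ w) hψ hφ hwψ (φ.map_target hwφ),
    cotangentCoord_lift hφ hwφ]

/-- The chart of `T*Q` induced by a chart of `Q`. -/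
noncomputable def cotangentChart (hφ : φ ∈ IsManifold.maximalAtlas (𝓡 2) ∞ Q) :
    OpenPartialHomeomorph (CotangentBundle Q) (E2 × E2Dual) where
  toFun := cotangentCoord φ
  invFun := cotangentLift φ
  source := cotangentOver φ.source
  target := φ.target ×ˢ univ
  map_source' _ hα := ⟨φ.map_source hα, mem_univ _⟩
  map_target' _ hz := φ.map_target hz.1
  left_inv' _ hα := cotangentLift_coord hφ hα
  right_inv' _ hz := cotangentCoord_lift hφ hz.1
  open_source := isOpen_cotangentOver φ.open_source
  open_target := φ.open_target.prod isOpen_univ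
  continuousOn_toFun _ hα := (contMDiffAt_cotangentCoord hφ hα).continuousAt.continuousWithinAt
  continuousOn_invFun _ hz := (contMDiffAt_cotangentLift hφ hz.1).continuousAt.continuousWithinAt

theorem mdifferentiable_cotangentChart (hφ : φ ∈ IsManifold.maximalAtlas (𝓡 2) ∞ Q) :
    (cotangentChart hφ).MDifferentiable cotModel 𝓘(ℝ, E2 × E2Dual) :=
  ⟨fun _ hα => ((contMDiffAt_cotangentCoord hφ hα).mdifferentiableAt
      (by simp)).mdifferentiableWithinAt,
    fun _ hz => ((contMDiffAt_cotangentLift hφ hz.1).mdifferentiableAt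
      (by simp)).mdifferentiableWithinAt⟩

/-- The differential at `α` of the coordinates `(q, p)` of `T*Q` induced by a chart `φ`. -/
noncomputable def cotangentDeriv (φ : OpenPartialHomeomorph Q E2) (α : CotangentBundle Q) :
    TangentSpace cotModel α →L[ℝ] E2 × E2Dual :=
  mfderiv cotModel 𝓘(ℝ, E2 × E2Dual) (cotangentCoord φ) α

theorem isInvertible_cotangentDeriv (hφ : φ ∈ IsManifold.maximalAtlas (𝓡 2) ∞ Q)
    {α : CotangentBundle Q} (hα : α.proj ∈ φ.source) : (cotangentDeriv φ α).IsInvertible :=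
  ⟨(mdifferentiable_cotangentChart hφ).mfderiv hα, rfl⟩

theorem mfderiv_eq_fderiv_comp_cotangentDeriv {G : Type*} [NormedAddCommGroup G]
    [NormedSpace ℝ G] (hφ : φ ∈ IsManifold.maximalAtlas (𝓡 2) ∞ Q)
    {α : CotangentBundle Q} (hα : α.proj ∈ φ.source) {f : CotangentBundle Q → G}
    {f' : E2 × E2Dual → G} (hf' : DifferentiableAt ℝ f' (cotangentCoord φ α))
    (hf : f =ᶠ[𝓝 α] f' ∘ cotangentCoord φ) :
    mfderiv cotModel 𝓘(ℝ, G) f α =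
      (fderiv ℝ f' (cotangentCoord φ α)).comp (cotangentDeriv φ α) := by
  refine hf.mfderiv_eq.trans ?_
  rw [mfderiv_comp α hf'.mdifferentiableAt
    ((mdifferentiable_cotangentChart hφ).mdifferentiableAt hα), mfderiv_eq_fderiv]
  rfl

theorem canonicalSymplectic_apply (hφ : φ ∈ IsManifold.maximalAtlas (𝓡 2) ∞ Q)
    {α : CotangentBundle Q} (hα : α.proj ∈ φ.source) (x y : TangentSpace cotModel α) :
    canonicalSymplectic α x y =
      stdSymplectic (cotangentDeriv φ α x) (cotangentDeriv φ α y) := by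
  have hψ := IsManifold.chart_mem_maximalAtlas (I := 𝓡 2) (n := ∞) α.proj
  have hαψ := mem_chart_source E2 α.proj
  have hτ := contDiffAt_transition hφ hψ hα hαψ
  have hσ : ContDiffAt ℝ ∞ (chartAt E2 α.proj ∘ φ.symm)
      ((φ ∘ (chartAt E2 α.proj).symm) (chartAt E2 α.proj α.proj)) := by
    simpa [hαψ] using contDiffAt_transition hψ hφ hαψ hα
  have hmap := contDiffAt_cotangentMap (z := cotangentCoord (chartAt E2 α.proj) α) hτ hσ
  have hcoord : cotangentCoord φ =ᶠ[𝓝 α] cotangentMap (φ ∘ (chartAt E2 α.proj).symm)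
      (chartAt E2 α.proj ∘ φ.symm) ∘ cotangentCoord (chartAt E2 α.proj) := by
    filter_upwards [eventually_proj_mem φ.open_source hα,
      eventually_proj_mem (chartAt E2 α.proj).open_source hαψ] with β hβφ hβψ
    exact cotangentCoord_eq_cotangentMap hφ hψ hβφ hβψ
  have hderiv : cotangentDeriv φ α = _ :=
    mfderiv_eq_fderiv_comp_cotangentDeriv hψ hαψ (hmap.differentiableAt (by simp)) hcoord
  rw [hderiv]
  exact (stdSymplectic_fderiv_cotangentMap hτ hσ
    (transition_comp_transition_eventuallyEq hαψ hα) _ _).symm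

theorem isInvertible_canonicalSymplectic (α : CotangentBundle Q) :
    (canonicalSymplectic α).IsInvertible := by
  have hD := isInvertible_cotangentDeriv (IsManifold.chart_mem_maximalAtlas α.proj)
    (mem_chart_source E2 α.proj)
  refine isInvertible_of_nondegenerate (E := E2 × E2Dual) _ fun x hx => hD.injective ?_
  refine (stdSymplectic_nondegenerate _ fun y => ?_).trans (ContinuousLinearMap.map_zero _).symm
  obtain ⟨w, rfl⟩ := hD.surjective y
  exact hx w

theorem canonicalSymplectic_hamiltonianVF (H : CotangentBundle Q → ℝ) (α : CotangentBundle Q) :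
    canonicalSymplectic α (hamiltonianVF H α) = mfderiv cotModel 𝓘(ℝ, ℝ) H α :=
  DFunLike.congr_fun (isInvertible_canonicalSymplectic α).self_comp_inverse _

theorem cotangentDeriv_hamiltonianVF (hφ : φ ∈ IsManifold.maximalAtlas (𝓡 2) ∞ Q)
    {α : CotangentBundle Q} (hα : α.proj ∈ φ.source) {H : CotangentBundle Q → ℝ}
    {K : E2 × E2Dual → ℝ} (hK : DifferentiableAt ℝ K (cotangentCoord φ α))
    (hH : H =ᶠ[𝓝 α] K ∘ cotangentCoord φ) :
    cotangentDeriv φ α (hamiltonianVF H α) = stdHamiltonianVF K (cotangentCoord φ α) := by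
  refine (stdHamiltonianVF_eq_of_forall fun y => ?_).symm
  obtain ⟨x, rfl⟩ := (isInvertible_cotangentDeriv hφ hα).surjective y
  rw [← canonicalSymplectic_apply hφ hα, canonicalSymplectic_hamiltonianVF,
    mfderiv_eq_fderiv_comp_cotangentDeriv hφ hα hK hH]
  rfl

theorem cotangentDeriv_vlift (hφ : φ ∈ IsManifold.maximalAtlas (𝓡 2) ∞ Q)
    {α : CotangentBundle Q} (hα : α.proj ∈ φ.source)
    (β : TangentSpace (𝓡 2) α.proj →L[ℝ] ℝ) :
    cotangentDeriv φ α (vlift α β) = (0, β.comp (chartDeriv φ α.proj).inverse) := by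
  let fibreLine : ℝ → CotangentBundle Q := fun t => ⟨α.proj, α.snd + t • β⟩
  let coordLine : ℝ → E2 × E2Dual := fun t => (φ α.proj,
    α.snd.comp (chartDeriv φ α.proj).inverse + t • β.comp (chartDeriv φ α.proj).inverse)
  have hlift : fibreLine = cotangentLift φ ∘ coordLine :=
    funext fun t => (cotangentLift_coord hφ (α := fibreLine t) hα).symm
  have hcoordLine : HasDerivAt coordLine (0, β.comp (chartDeriv φ α.proj).inverse) 0 := by
    refine (hasDerivAt_const (0 : ℝ) (φ α.proj)).prodMk ?_
    simpa using ((hasDerivAt_id (0 : ℝ)).smul_const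
      (β.comp (chartDeriv φ α.proj).inverse)).const_add (α.snd.comp (chartDeriv φ α.proj).inverse)
  have hfibreLine : MDifferentiableAt 𝓘(ℝ, ℝ) cotModel fibreLine 0 := by
    rw [hlift]
    exact ((contMDiffAt_cotangentLift hφ (φ.map_source hα)).mdifferentiableAt (by simp)).comp
      (0 : ℝ) hcoordLine.differentiableAt.mdifferentiableAt
  have hstart : fibreLine 0 = α := by simp [fibreLine]
  have hchain := mfderiv_comp_apply_of_eq (0 : ℝ) (v := (1 : ℝ))
    ((mdifferentiable_cotangentChart hφ).mdifferentiableAt hα) hfibreLine hstart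
  refine hchain.symm.trans ?_
  change mfderiv 𝓘(ℝ, ℝ) 𝓘(ℝ, E2 × E2Dual) coordLine 0 (1 : ℝ) = _
  rw [mfderiv_eq_fderiv]
  exact hcoordLine.deriv

end Charts

section MetricCoordinates

variable {Q : Type*} [TopologicalSpace Q] [ChartedSpace E2 Q] {φ ψ : OpenPartialHomeomorph Q E2}
  {g : ∀ q : Q, TangentSpace (𝓡 2) q →L[ℝ] TangentSpace (𝓡 2) q →L[ℝ] ℝ} {q : Q}

/-- The expression of a family `g` of bilinear forms on the tangent spaces of `Q` in the
coordinates of a chart `φ`. -/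
noncomputable def metricCoord (φ : OpenPartialHomeomorph Q E2)
    (g : ∀ q : Q, TangentSpace (𝓡 2) q →L[ℝ] TangentSpace (𝓡 2) q →L[ℝ] ℝ) (x : E2) :
    E2 →L[ℝ] E2 →L[ℝ] ℝ :=
  let frame : E2 →L[ℝ] E2 := (chartDeriv φ (φ.symm x)).inverse
  let form : E2 →L[ℝ] E2 →L[ℝ] ℝ := g (φ.symm x)
  form.bilinearComp frame frame

/-- The pullback to `Q` by a chart `φ` of a family `B` of bilinear forms on `ℝ²`. -/
noncomputable def pullbackMetric (φ : OpenPartialHomeomorph Q E2) (B : E2 → E2 →L[ℝ] E2 →L[ℝ] ℝ)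
    (q : Q) : TangentSpace (𝓡 2) q →L[ℝ] TangentSpace (𝓡 2) q →L[ℝ] ℝ :=
  let coframe : E2 →L[ℝ] E2 := chartDeriv φ q
  (B (φ q)).bilinearComp coframe coframe

theorem pullbackMetric_apply (B : E2 → E2 →L[ℝ] E2 →L[ℝ] ℝ) (u w : TangentSpace (𝓡 2) q) :
    pullbackMetric φ B q u w = B (φ q) (chartDeriv φ q u) (chartDeriv φ q w) :=
  rfl

theorem metricCoord_apply (hq : q ∈ φ.source) (u w : E2) :
    metricCoord φ g (φ q) u w =
      g q ((chartDeriv φ q).inverse u) ((chartDeriv φ q).inverse w) := by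
  change g (φ.symm (φ q)) ((chartDeriv φ (φ.symm (φ q))).inverse u)
    ((chartDeriv φ (φ.symm (φ q))).inverse w) = _
  rw [φ.left_inv hq]

theorem metricCoord_chartDeriv (hφ : φ ∈ IsManifold.maximalAtlas (𝓡 2) ∞ Q) (hq : q ∈ φ.source)
    (u w : TangentSpace (𝓡 2) q) :
    metricCoord φ g (φ q) (chartDeriv φ q u) (chartDeriv φ q w) = g q u w := by
  have hchart := isInvertible_chartDeriv hφ hq
  rw [metricCoord_apply hq, hchart.inverse_apply_self, hchart.inverse_apply_self]

theorem metricCoord_pullbackMetric (hφ : φ ∈ IsManifold.maximalAtlas (𝓡 2) ∞ Q)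
    (B : E2 → E2 →L[ℝ] E2 →L[ℝ] ℝ) {x : E2} (hx : x ∈ φ.target) :
    metricCoord φ (pullbackMetric φ B) x = B x := by
  have hchart := isInvertible_chartDeriv hφ (φ.map_target hx)
  ext u w
  obtain ⟨u', rfl⟩ := hchart.surjective u
  obtain ⟨w', rfl⟩ := hchart.surjective w
  have hcoord := metricCoord_chartDeriv (g := pullbackMetric φ B) hφ (φ.map_target hx) u' w'
  rwa [pullbackMetric_apply, φ.right_inv hx] at hcoord

theorem metricCoord_eq_bilinearComp (hφ : φ ∈ IsManifold.maximalAtlas (𝓡 2) ∞ Q)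
    (hψ : ψ ∈ IsManifold.maximalAtlas (𝓡 2) ∞ Q) (hqφ : q ∈ φ.source) (hqψ : q ∈ ψ.source) :
    metricCoord φ g (φ q) = (metricCoord ψ g (ψ q)).bilinearComp
      (fderiv ℝ (ψ ∘ φ.symm) (φ q)) (fderiv ℝ (ψ ∘ φ.symm) (φ q)) := by
  ext u w
  rw [← chartDeriv_comp_inverse hψ hφ hqψ hqφ, metricCoord_apply hqφ]
  exact (metricCoord_chartDeriv hψ hqψ _ _).symm

theorem contDiff_bilinearComp {F G : Type*} [NormedAddCommGroup F] [NormedSpace ℝ F]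
    [FiniteDimensional ℝ F] [NormedAddCommGroup G] [NormedSpace ℝ G] :
    ContDiff ℝ ∞ fun p : (G →L[ℝ] G →L[ℝ] ℝ) × (F →L[ℝ] G) => p.1.bilinearComp p.2 p.2 :=
  contDiff_clm_apply_iff.2 fun _ => contDiff_clm_apply_iff.2 fun _ =>
    (contDiff_fst.clm_apply (contDiff_snd.clm_apply contDiff_const)).clm_apply
      (contDiff_snd.clm_apply contDiff_const)

theorem contDiffAt_metricCoord_of_chart (hφ : φ ∈ IsManifold.maximalAtlas (𝓡 2) ∞ Q)
    (hψ : ψ ∈ IsManifold.maximalAtlas (𝓡 2) ∞ Q) (hqφ : q ∈ φ.source) (hqψ : q ∈ ψ.source)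
    (hg : ContDiffAt ℝ ∞ (metricCoord ψ g) (ψ q)) : ContDiffAt ℝ ∞ (metricCoord φ g) (φ q) := by
  have htrans := contDiffAt_transition hψ hφ hqψ hqφ
  have hbase : ContDiffAt ℝ ∞ (metricCoord ψ g ∘ (ψ ∘ φ.symm)) (φ q) :=
    ContDiffAt.comp (φ q) (by simpa [hqφ] using hg) htrans
  refine (contDiff_bilinearComp.contDiffAt.comp (φ q)
    (hbase.prodMk (htrans.fderiv_right (m := ∞) (by simp)))).congr_of_eventuallyEq ?_
  have hψ_near : ∀ᶠ x in 𝓝 (φ q), φ.symm x ∈ ψ.source :=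
    (φ.continuousAt_symm (φ.map_source hqφ)).eventually
      (ψ.open_source.mem_nhds (by rwa [φ.left_inv hqφ]))
  filter_upwards [φ.open_target.mem_nhds (φ.map_source hqφ), hψ_near] with x hxφ hxψ
  have hcoord := metricCoord_eq_bilinearComp (g := g) hφ hψ (φ.map_target hxφ) hxψ
  rwa [φ.right_inv hxφ] at hcoord

theorem kineticMatrix_apply {s : Set E2} (hG : IsMetricOn (metricCoord φ g) s)
    (hq : q ∈ φ.source) (hqs : φ q ∈ s) (i j : Fin 2) :
    kineticMatrix g φ q i j =
      (metricCoord φ g (φ q)).inverse (EuclideanSpace.proj j : E2Dual) i := by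
  set G := metricCoord φ g (φ q)
  have hgram : (Matrix.of fun i j => g q (coordVec φ i q) (coordVec φ j q)) =
      Matrix.of fun i j => G (EuclideanSpace.single i 1) (EuclideanSpace.single j 1) := by
    ext k l
    exact (metricCoord_apply hq _ _).symm
  suffices hinv : (Matrix.of fun k l => G (EuclideanSpace.single k 1) (EuclideanSpace.single l 1)) *
      (Matrix.of fun k l => G.inverse (EuclideanSpace.proj l : E2Dual) k) = 1 by
    rw [kineticMatrix, hgram, Matrix.inv_eq_right_inv hinv, Matrix.of_apply]
  ext k l
  have hexpand : ∀ p : E2Dual, ∀ w : E2, p w = ∑ m, p (EuclideanSpace.single m 1) * w m := by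
    intro p w
    conv_lhs => rw [← (EuclideanSpace.basisFun (Fin 2) ℝ).sum_repr w]
    simp [mul_comm]
  simp only [Matrix.mul_apply, Matrix.of_apply]
  rw [← hexpand, hG.symm _ hqs, hG.apply_inverse hqs]
  simp [Matrix.one_apply, eq_comm]

theorem inverse_metric_eq (hφ : φ ∈ IsManifold.maximalAtlas (𝓡 2) ∞ Q) (hq : q ∈ φ.source)
    (hG : (metricCoord φ g (φ q)).IsInvertible) (p : TangentSpace (𝓡 2) q →L[ℝ] ℝ) :
    (g q).inverse p = (chartDeriv φ q).inverse
      ((metricCoord φ g (φ q)).inverse (p.comp (chartDeriv φ q).inverse)) := by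
  have hchart := isInvertible_chartDeriv hφ hq
  have hinv : (g q).IsInvertible := by
    refine isInvertible_of_nondegenerate (E := E2) _ fun u hu => hchart.injective ?_
    refine (hG.injective ?_).trans (ContinuousLinearMap.map_zero _).symm
    rw [map_zero]
    ext w
    obtain ⟨w', rfl⟩ := hchart.surjective w
    exact (metricCoord_chartDeriv hφ hq u w').trans (hu w')
  set x := (metricCoord φ g (φ q)).inverse (p.comp (chartDeriv φ q).inverse) with hx
  have hsolve : g q ((chartDeriv φ q).inverse x) = p := by
    ext w
    rw [← metricCoord_chartDeriv (g := g) hφ hq, hchart.self_apply_inverse, hx,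
      hG.self_apply_inverse, ContinuousLinearMap.comp_apply, hchart.inverse_apply_self]
  rw [← hsolve, hinv.inverse_apply_self]

theorem simpleFn_eq_localSimple (hφ : φ ∈ IsManifold.maximalAtlas (𝓡 2) ∞ Q) (v : Q → ℝ)
    {α : CotangentBundle Q} (hα : α.proj ∈ φ.source)
    (hG : (metricCoord φ g (φ α.proj)).IsInvertible) :
    simpleFn g v α = localSimple (fun x => (metricCoord φ g x).inverse) (v ∘ φ.symm)
      (cotangentCoord φ α) := by
  rw [simpleFn, inverse_metric_eq hφ hα hG]
  simp only [localSimple, cotangentCoord, Function.comp_apply, φ.left_inv hα,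
    ContinuousLinearMap.comp_apply]

theorem simpleFn_pullbackMetric (hφ : φ ∈ IsManifold.maximalAtlas (𝓡 2) ∞ Q) {U : Set E2}
    {B : E2 → E2 →L[ℝ] E2 →L[ℝ] ℝ} (hB : IsMetricOn B U) (v : E2 → ℝ) {α : CotangentBundle Q}
    (hα : α ∈ (cotangentOver (φ.source ∩ φ ⁻¹' U) : Set (CotangentBundle Q))) :
    simpleFn (pullbackMetric φ B) (v ∘ φ) α =
      localSimple (fun x => (B x).inverse) v (cotangentCoord φ α) := by
  have htarget := φ.map_source hα.1
  have hmetric := metricCoord_pullbackMetric hφ B htarget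
  rw [simpleFn_eq_localSimple hφ _ hα.1 (hmetric ▸ hB.isInvertible hα.2)]
  simp only [localSimple, cotangentCoord, Function.comp_apply, hmetric, φ.left_inv hα.1]

section Smooth

variable [IsManifold (𝓡 2) ∞ Q]

theorem inCoordinates_metric_eq {q₁ : Q} (hq : q ∈ (chartAt E2 q₁).source) :
    ContinuousLinearMap.inCoordinates E2 (TangentSpace (𝓡 2)) E2Dual
      (fun q : Q => TangentSpace (𝓡 2) q →L[ℝ] ℝ) q₁ q q₁ q (g q) =
      metricCoord (chartAt E2 q₁) g (chartAt E2 q₁ q) := by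
  ext v w
  rw [metricCoord_apply hq, ← symmL_trivializationAt_eq_chartDeriv_inverse hq]
  refine (inCoordinates_apply_eq₂ (F₁ := E2) (F₂ := E2) (F₃ := ℝ) (E₁ := TangentSpace (𝓡 2))
    (E₂ := TangentSpace (𝓡 2)) (E₃ := Bundle.Trivial Q ℝ) (x₀ := q₁) (x := q)
    (by simpa using hq) (by simpa using hq) (by simp)).trans ?_
  rw [Trivialization.symmL_apply _ (by simpa using hq),
    Trivialization.symmL_apply _ (by simpa using hq)]
  simp

theorem contMDiffAt_iff_contDiffAt_metricCoord (hφ : φ ∈ IsManifold.maximalAtlas (𝓡 2) ∞ Q)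
    (hq : q ∈ φ.source) :
    ContMDiffAt (𝓡 2) ((𝓡 2).prod 𝓘(ℝ, E2 →L[ℝ] E2 →L[ℝ] ℝ)) ∞
      (fun q' : Q => TotalSpace.mk' (E2 →L[ℝ] E2 →L[ℝ] ℝ) q' (g q')) q ↔
      ContDiffAt ℝ ∞ (metricCoord φ g) (φ q) := by
  have hψ := IsManifold.chart_mem_maximalAtlas (I := 𝓡 2) (n := ∞) q
  have hqψ := mem_chart_source E2 q
  have hchart : ContDiffAt ℝ ∞ (metricCoord φ g) (φ q) ↔
      ContDiffAt ℝ ∞ (metricCoord (chartAt E2 q) g) (chartAt E2 q q) :=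
    ⟨contDiffAt_metricCoord_of_chart hψ hφ hqψ hq, contDiffAt_metricCoord_of_chart hφ hψ hq hqψ⟩
  rw [hchart, contMDiffAt_hom_bundle]
  have hnear : (fun q' => ContinuousLinearMap.inCoordinates E2 (TangentSpace (𝓡 2)) E2Dual
      (fun q : Q => TangentSpace (𝓡 2) q →L[ℝ] ℝ) q q' q q' (g q')) =ᶠ[𝓝 q]
      metricCoord (chartAt E2 q) g ∘ chartAt E2 q := by
    filter_upwards [(chartAt E2 q).open_source.mem_nhds hqψ] with q' hq'
    exact inCoordinates_metric_eq hq'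
  refine (and_iff_right contMDiffAt_id).trans (hnear.contMDiffAt_iff.trans ⟨fun hcomp => ?_,
    fun hcoord => hcoord.contMDiffAt.comp q (contMDiffAt_of_mem_maximalAtlas hψ hqψ)⟩)
  have hq' := (chartAt E2 q).map_source hqψ
  refine ContDiffAt.congr_of_eventuallyEq (contMDiffAt_iff_contDiffAt.1
    (ContMDiffAt.comp (chartAt E2 q q) (by simpa using hcomp)
      (contMDiffAt_symm_of_mem_maximalAtlas hψ hq'))) ?_
  filter_upwards [(chartAt E2 q).open_target.mem_nhds hq'] with x hx
  simp [hx]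

theorem isMetricOn_metricCoord (hφ : φ ∈ IsManifold.maximalAtlas (𝓡 2) ∞ Q)
    (hg : IsRiemannianMetricOn g φ.source) : IsMetricOn (metricCoord φ g) φ.target where
  symm _ hx _ _ := hg.symm _ (φ.map_target hx) _ _
  pos _ hx _ hu := hg.pos _ (φ.map_target hx) _ fun hzero => hu <|
    (isInvertible_chartDeriv hφ (φ.map_target hx)).inverse.injective
      (hzero.trans (ContinuousLinearMap.map_zero _).symm)
  smooth x hx := by
    have hsymm := φ.map_target hx
    have hcoord := (contMDiffAt_iff_contDiffAt_metricCoord hφ hsymm).1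
      ((hg.smooth _ hsymm).contMDiffAt (φ.open_source.mem_nhds hsymm))
    rw [φ.right_inv hx] at hcoord
    exact hcoord.contDiffWithinAt

theorem isRiemannianMetricOn_pullbackMetric (hφ : φ ∈ IsManifold.maximalAtlas (𝓡 2) ∞ Q)
    {U : Set E2} (hU : IsOpen U) {B : E2 → E2 →L[ℝ] E2 →L[ℝ] ℝ} (hB : IsMetricOn B U) :
    IsRiemannianMetricOn (pullbackMetric φ B) (φ.source ∩ φ ⁻¹' U) where
  symm _ hq _ _ := hB.symm _ hq.2 _ _
  pos _ hq _ hu := hB.pos _ hq.2 _ fun hzero => hu <|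
    (isInvertible_chartDeriv hφ hq.1).injective (hzero.trans (ContinuousLinearMap.map_zero _).symm)
  smooth q hq := by
    refine ((contMDiffAt_iff_contDiffAt_metricCoord hφ hq.1).2 ?_).contMDiffWithinAt
    refine (hB.smooth.contDiffAt (hU.mem_nhds hq.2)).congr_of_eventuallyEq ?_
    filter_upwards [φ.open_target.mem_nhds (φ.map_source hq.1)] with x hx
    exact metricCoord_pullbackMetric hφ B hx

end Smooth

end MetricCoordinates

section ClosedLoop

variable {Q : Type*} [TopologicalSpace Q] [ChartedSpace E2 Q] {φ : OpenPartialHomeomorph Q E2}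
  {ρ : ∀ q : Q, TangentSpace (𝓡 2) q →L[ℝ] TangentSpace (𝓡 2) q →L[ℝ] ℝ} {h : Q → ℝ} {q₀ : Q}
  {ξ : ∀ q : Q, TangentSpace (𝓡 2) q →L[ℝ] ℝ} {u : E2 × E2Dual → ℝ}

theorem coordDiff_eq_proj_comp_chartDeriv (hφ : φ ∈ IsManifold.maximalAtlas (𝓡 2) ∞ Q) {q : Q}
    (hq : q ∈ φ.source) (i : Fin 2) :
    coordDiff φ i q = (EuclideanSpace.proj i : E2Dual).comp (chartDeriv φ q) :=
  ((EuclideanSpace.proj i : E2Dual).hasFDerivAt.hasMFDerivAt.comp q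
    ((mdifferentiable_chart hφ).mdifferentiableAt hq).hasMFDerivAt).mfderiv

theorem contDiffOn_comp_symm (hφ : φ ∈ IsManifold.maximalAtlas (𝓡 2) ∞ Q)
    (hh : ContMDiffOn (𝓡 2) 𝓘(ℝ, ℝ) ∞ h φ.source) : ContDiffOn ℝ ∞ (h ∘ φ.symm) φ.target :=
  contMDiffOn_iff_contDiffOn.1
    (hh.comp (contMDiffOn_symm_of_mem_maximalAtlas hφ) fun _ hx => φ.map_target hx)

theorem positivityCondition_iff (hρ : IsMetricOn (metricCoord φ ρ) φ.target)
    (hq₀ : q₀ ∈ φ.source) (hφ0 : φ q₀ = 0) :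
    PositivityCondition ρ h φ q₀ ↔
      (metricCoord φ ρ 0).inverse 𝐝₁ 0 * partialDeriv 0 (partialDeriv 0 (h ∘ φ.symm)) 0 +
          (metricCoord φ ρ 0).inverse 𝐝₁ 1 * partialDeriv 1 (partialDeriv 0 (h ∘ φ.symm)) 0 ≠ 0 ∨
        0 < partialDeriv 0 (partialDeriv 0 (h ∘ φ.symm)) 0 := by
  have hkinetic (i : Fin 2) : kineticMatrix ρ φ q₀ i 1 = (metricCoord φ ρ 0).inverse 𝐝₁ i := by
    rw [kineticMatrix_apply hρ hq₀ (φ.map_source hq₀), hφ0]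
  simp only [PositivityCondition, hkinetic]
  rfl

variable [IsManifold (𝓡 2) ∞ Q]

theorem cotangentDeriv_hamiltonianVF_simpleFn (hφ : φ ∈ IsManifold.maximalAtlas (𝓡 2) ∞ Q)
    (hρ : IsMetricOn (metricCoord φ ρ) φ.target)
    (hh : ContDiffOn ℝ ∞ (h ∘ φ.symm) φ.target) {α : CotangentBundle Q}
    (hα : α.proj ∈ φ.source) :
    cotangentDeriv φ α (hamiltonianVF (simpleFn ρ h) α) =
      stdHamiltonianVF (localSimple (fun x => (metricCoord φ ρ x).inverse) (h ∘ φ.symm))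
        (cotangentCoord φ α) := by
  refine cotangentDeriv_hamiltonianVF hφ hα (differentiableAt_of_contDiffOn
    (φ.open_target.prod isOpen_univ) (contDiffOn_localSimple hρ.isCometricOn_inverse.smooth hh)
    ⟨φ.map_source hα, mem_univ _⟩) ?_
  filter_upwards [eventually_proj_mem φ.open_source hα] with β hβ
  exact simpleFn_eq_localSimple hφ h hβ (hρ.isInvertible (φ.map_source hβ))

theorem fderiv_potential_eq_zero (hφ : φ ∈ IsManifold.maximalAtlas (𝓡 2) ∞ Q)
    (hρ : IsMetricOn (metricCoord φ ρ) φ.target)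
    (hh : ContDiffOn ℝ ∞ (h ∘ φ.symm) φ.target) (hq₀ : q₀ ∈ φ.source)
    (hcrit : hamiltonianVF (simpleFn ρ h) (nullPoint q₀) = 0) :
    fderiv ℝ (h ∘ φ.symm) (φ q₀) = 0 := by
  have hA := hρ.isCometricOn_inverse
  have htarget := φ.map_source hq₀
  have hnull : cotangentCoord φ (nullPoint q₀) = (φ q₀, 0) :=
    Prod.ext rfl (ContinuousLinearMap.zero_comp _)
  have hlocal := cotangentDeriv_hamiltonianVF_simpleFn (α := nullPoint q₀) hφ hρ hh hq₀
  rw [hcrit, hnull, stdHamiltonianVF_localSimple (hA.differentiableAt φ.open_target htarget)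
    (hA.symm _ htarget) (differentiableAt_of_contDiffOn φ.open_target hh htarget)] at hlocal
  have hforce := congrArg Prod.snd (((cotangentDeriv φ (nullPoint q₀)).map_zero).symm.trans hlocal)
  simpa [eq_comm] using hforce

/-- The vertical vector field whose only component in the coordinates induced by `φ` is the force
`u` along the second momentum. -/
noncomputable def controlField (φ : OpenPartialHomeomorph Q E2) (u : E2 × E2Dual → ℝ)
    (α : CotangentBundle Q) : TangentSpace cotModel α :=
  (cotangentDeriv φ α).inverse (u (cotangentCoord φ α) • (0, 𝐝₁))

theorem cotangentDeriv_controlField (hφ : φ ∈ IsManifold.maximalAtlas (𝓡 2) ∞ Q)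
    {α : CotangentBundle Q} (hα : α.proj ∈ φ.source) :
    cotangentDeriv φ α (controlField φ u α) = u (cotangentCoord φ α) • (0, 𝐝₁) :=
  (isInvertible_cotangentDeriv hφ hα).self_apply_inverse _

theorem cotangentDeriv_hamiltonianVF_add_controlField
    (hφ : φ ∈ IsManifold.maximalAtlas (𝓡 2) ∞ Q) (hρ : IsMetricOn (metricCoord φ ρ) φ.target)
    (hh : ContDiffOn ℝ ∞ (h ∘ φ.symm) φ.target) {α : CotangentBundle Q}
    (hα : α.proj ∈ φ.source) :
    cotangentDeriv φ α (hamiltonianVF (simpleFn ρ h) α + controlField φ u α) =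
      stdHamiltonianVF (localSimple (fun x => (metricCoord φ ρ x).inverse) (h ∘ φ.symm))
        (cotangentCoord φ α) + u (cotangentCoord φ α) • (0, 𝐝₁) := by
  rw [ContinuousLinearMap.map_add, cotangentDeriv_hamiltonianVF_simpleFn hφ hρ hh hα,
    cotangentDeriv_controlField hφ hα]

theorem controlField_eq_zero {α : CotangentBundle Q} (hu : u (cotangentCoord φ α) = 0) :
    controlField φ u α = 0 := by
  rw [controlField, hu, zero_smul]
  exact ContinuousLinearMap.map_zero _

theorem isSmoothVFOn_controlField (hφ : φ ∈ IsManifold.maximalAtlas (𝓡 2) ∞ Q) {U : Set E2}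
    (hU : IsOpen U) (hu : ContDiffOn ℝ ∞ u (U ×ˢ univ)) :
    IsSmoothVFOn (controlField φ u)
      (cotangentOver (φ.source ∩ φ ⁻¹' U) : Set (CotangentBundle Q)) := fun α hα => by
  have hforce : ContDiffAt ℝ ∞ (fun z => u z • ((0, 𝐝₁) : E2 × E2Dual)) (cotangentCoord φ α) :=
    (hu.contDiffAt ((hU.prod isOpen_univ).mem_nhds (mk_mem_prod hα.2 (mem_univ _)))).smul
      contDiffAt_const
  exact ((contMDiffAt_vectorSpace_iff_contDiffAt.2 hforce).mpullback_vectorField_preimage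
    (contMDiffAt_cotangentCoord hφ hα.1) (isInvertible_cotangentDeriv hφ hα.1)
    (by simp)).contMDiffWithinAt

theorem controlField_mem_actuation (hφ : φ ∈ IsManifold.maximalAtlas (𝓡 2) ∞ Q)
    (hξ : IsAdapted ξ φ) {α : CotangentBundle Q} (hα : α.proj ∈ φ.source) :
    controlField φ u α ∈ actuation ξ α := by
  obtain ⟨k, hk⟩ : ∃ k : ℝ, k • ξ α.proj = coordDiff φ 1 α.proj :=
    Submodule.mem_span_singleton.1 (hξ _ hα ▸ Submodule.mem_span_singleton_self _)
  have hmomentum : k • (ξ α.proj).comp (chartDeriv φ α.proj).inverse = 𝐝₁ := by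
    rw [← ContinuousLinearMap.smul_comp, hk, coordDiff_eq_proj_comp_chartDeriv hφ hα,
      ContinuousLinearMap.comp_assoc, (isInvertible_chartDeriv hφ hα).self_comp_inverse]
    rfl
  refine Submodule.mem_span_singleton.2 ⟨u (cotangentCoord φ α) * k,
    (isInvertible_cotangentDeriv hφ hα).injective ?_⟩
  rw [ContinuousLinearMap.map_smul, cotangentDeriv_vlift hφ hα,
    cotangentDeriv_controlField hφ hα, ← hmomentum, mul_smul]
  exact congrArg _ (Prod.ext (smul_zero k) rfl)

theorem isStableAt_hamiltonianVF_add_controlField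
    (hφ : φ ∈ IsManifold.maximalAtlas (𝓡 2) ∞ Q) (hρ : IsMetricOn (metricCoord φ ρ) φ.target)
    (hh : ContDiffOn ℝ ∞ (h ∘ φ.symm) φ.target) {U : Set E2} (hU : IsOpen U) (hUt : U ⊆ φ.target)
    (hu : ContDiffOn ℝ ∞ u (U ×ˢ univ)) {V : CotangentBundle Q → ℝ} {α₀ : CotangentBundle Q}
    (hV : IsLyapunovOn cotModel (fun α => hamiltonianVF (simpleFn ρ h) α + controlField φ u α) V
      (cotangentOver (φ.source ∩ φ ⁻¹' U)) α₀) :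
    IsStableAt cotModel (fun α => hamiltonianVF (simpleFn ρ h) α + controlField φ u α)
      (cotangentOver (φ.source ∩ φ ⁻¹' U)) α₀ := by
  have hsmooth : ContDiffOn ℝ ∞ (fun z =>
      stdHamiltonianVF (localSimple (fun x => (metricCoord φ ρ x).inverse) (h ∘ φ.symm)) z +
        u z • ((0, 𝐝₁) : E2 × E2Dual)) (U ×ˢ univ) :=
    (contDiffOn_stdHamiltonianVF (hU.prod isOpen_univ) (contDiffOn_localSimple
      (hρ.isCometricOn_inverse.smooth.mono hUt) (hh.mono hUt))).add (hu.smul contDiffOn_const)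
  refine hV.isStableAt (mdifferentiable_cotangentChart hφ)
    (isOpen_cotangentOver (φ.isOpen_inter_preimage hU)) (fun α hα => hα.1)
    (fun α hα => cotangentDeriv_hamiltonianVF_add_controlField hφ hρ hh hα.1)
    ((hsmooth.of_le (by simp)).mono ?_)
  rintro _ ⟨α, hα, rfl⟩
  exact ⟨hα.2, mem_univ _⟩

section Lyapunov

variable {X : ∀ α : CotangentBundle Q, TangentSpace cotModel α} {X' : E2 × E2Dual → E2 × E2Dual}
  {U : Set E2}

theorem isLyapunovOn_simpleFn_pullbackMetric (hφ : φ ∈ IsManifold.maximalAtlas (𝓡 2) ∞ Q)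
    (hq₀ : q₀ ∈ φ.source) (hφ0 : φ q₀ = 0) (hU : IsOpen U) (h0U : 0 ∈ U)
    {G : E2 → E2 →L[ℝ] E2 →L[ℝ] ℝ} (hG : IsMetricOn G U) {v : E2 → ℝ} (hv : ContDiffOn ℝ ∞ v U)
    (hv0 : v 0 = 0) (hvpos : ∀ x ∈ U, x ≠ 0 → 0 < v x) (hX₀ : X (nullPoint q₀) = 0)
    (hX : ∀ α ∈ (cotangentOver (φ.source ∩ φ ⁻¹' U) : Set (CotangentBundle Q)),
      cotangentDeriv φ α (X α) = X' (cotangentCoord φ α))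
    (hdec : ∀ z ∈ U ×ˢ univ, fderiv ℝ (localSimple (fun x => (G x).inverse) v) z (X' z) ≤ 0) :
    IsLyapunovOn cotModel X (simpleFn (pullbackMetric φ G) (v ∘ φ))
      (cotangentOver (φ.source ∩ φ ⁻¹' U)) (nullPoint q₀) := by
  have hA := hG.isCometricOn_inverse
  have hmem : nullPoint q₀ ∈ (cotangentOver (φ.source ∩ φ ⁻¹' U) : Set (CotangentBundle Q)) :=
    ⟨hq₀, (hφ0 ▸ h0U : φ q₀ ∈ U)⟩
  have hnull := cotangentCoord_nullPoint hφ0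
  have hsmooth (α : CotangentBundle Q) (hα : α ∈ cotangentOver (φ.source ∩ φ ⁻¹' U)) :
      ContDiffAt ℝ ∞ (localSimple (fun x => (G x).inverse) v) (cotangentCoord φ α) :=
    (contDiffOn_localSimple hA.smooth hv).contDiffAt
      ((hU.prod isOpen_univ).mem_nhds ⟨hα.2, mem_univ _⟩)
  have heq (α : CotangentBundle Q) (hα : α ∈ cotangentOver (φ.source ∩ φ ⁻¹' U)) :=
    simpleFn_pullbackMetric hφ hG v hα
  refine ⟨hmem, hX₀, fun α hα => ?_, ?_, fun α hα hne => ?_, fun α hα => ?_⟩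
  · exact (((hsmooth α hα).contMDiffAt.comp α
      (contMDiffAt_cotangentCoord hφ hα.1)).contMDiffWithinAt).congr heq (heq α hα)
  · rw [heq _ hmem, hnull]
    simp [localSimple, hv0]
  · rw [heq α hα]
    refine localSimple_pos hA hv0 hvpos hα.2 fun hzero => hne ?_
    exact (cotangentChart hφ).injOn hα.1 hmem.1 (hzero.trans hnull.symm)
  · have hnear := ((isOpen_cotangentOver (φ.isOpen_inter_preimage hU)).eventually_mem hα).mono heq
    rw [derivAlong, mfderiv_eq_fderiv_comp_cotangentDeriv hφ hα.1
      ((hsmooth α hα).differentiableAt (by simp)) hnear]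
    exact (congrArg _ (hX α hα)).trans_le (hdec _ ⟨hα.2, mem_univ _⟩)

end Lyapunov

end ClosedLoop

end LCB

open LCB in
theorem mainTheorem3_general {Q : Type*} [TopologicalSpace Q] [ChartedSpace E2 Q]
    [IsManifold (𝓡 2) ∞ Q] (φ : OpenPartialHomeomorph Q E2)
    (hφ : φ ∈ IsManifold.maximalAtlas (𝓡 2) ∞ Q)
    (ρ : ∀ q : Q, TangentSpace (𝓡 2) q →L[ℝ] TangentSpace (𝓡 2) q →L[ℝ] ℝ)
    (hρ : IsRiemannianMetricOn ρ φ.source)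
    (h : Q → ℝ) (hh : ContMDiffOn (𝓡 2) 𝓘(ℝ, ℝ) ∞ h φ.source)
    (ξ : ∀ q : Q, TangentSpace (𝓡 2) q →L[ℝ] ℝ) (hφξ : IsAdapted ξ φ)
    (q₀ : Q) (hq₀ : q₀ ∈ φ.source) (hφ0 : φ q₀ = 0)
    (hcrit : hamiltonianVF (simpleFn ρ h) (nullPoint q₀) = 0)
    (hpos : PositivityCondition ρ h φ q₀) :
    ∃ (U : Set Q) (Y : ∀ α : CotangentBundle Q, TangentSpace cotModel α),
      IsOpen U ∧ q₀ ∈ U ∧ IsSmoothVFOn Y (cotangentOver U) ∧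
      (∀ α ∈ cotangentOver U, Y α ∈ actuation ξ α) ∧
      IsStableAt cotModel (fun α => hamiltonianVF (simpleFn ρ h) α + Y α)
        (cotangentOver U) (nullPoint q₀) ∧
      ∃ (g : ∀ q : Q, TangentSpace (𝓡 2) q →L[ℝ] TangentSpace (𝓡 2) q →L[ℝ] ℝ) (v : Q → ℝ),
        IsRiemannianMetricOn g U ∧ ContMDiffOn (𝓡 2) 𝓘(ℝ, ℝ) ∞ v U ∧
        IsLyapunovOn cotModel (fun α => hamiltonianVF (simpleFn ρ h) α + Y α)
          (simpleFn g v) (cotangentOver U) (nullPoint q₀) := by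
  have h0 : 0 ∈ φ.target := hφ0 ▸ φ.map_source hq₀
  have hG := isMetricOn_metricCoord hφ hρ
  have hhloc := contDiffOn_comp_symm hφ hh
  have hcritloc : fderiv ℝ (h ∘ φ.symm) 0 = 0 :=
    hφ0 ▸ fderiv_potential_eq_zero hφ hG hhloc hq₀ hcrit
  obtain ⟨U, G, v, u, hU, h0U, hUt, hGU, hv, hv0, hvpos, hu, hu0, hconserved⟩ :=
    exists_localSimple_feedback φ.open_target h0 hG.isCometricOn_inverse hhloc hcritloc
      ((positivityCondition_iff hG hq₀ hφ0).1 hpos)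
  have hnull : cotangentCoord φ (nullPoint q₀) = 0 := cotangentCoord_nullPoint hφ0
  have hX (α : CotangentBundle Q) (hα : α ∈ cotangentOver (φ.source ∩ φ ⁻¹' U)) :=
    cotangentDeriv_hamiltonianVF_add_controlField (u := u) hφ hG hhloc hα.1
  have hX₀ : hamiltonianVF (simpleFn ρ h) (nullPoint q₀) + controlField φ u (nullPoint q₀) = 0 := by
    rw [hcrit, controlField_eq_zero (by rw [hnull, hu0]), add_zero]
  have hlyapunov := isLyapunovOn_simpleFn_pullbackMetric hφ hq₀ hφ0 hU h0U hGU hv hv0 hvpos hX₀ hX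
    fun z hz => (hconserved z hz).le
  refine ⟨φ.source ∩ φ ⁻¹' U, controlField φ u, φ.isOpen_inter_preimage hU, hlyapunov.mem,
    isSmoothVFOn_controlField hφ hU hu, fun α hα => controlField_mem_actuation hφ hφξ hα.1,
    isStableAt_hamiltonianVF_add_controlField hφ hG hhloc hU hUt hu hlyapunov,
    pullbackMetric φ G, v ∘ φ, isRiemannianMetricOn_pullbackMetric hφ hU hGU, ?_, hlyapunov⟩
  exact (contMDiffOn_iff_contDiffOn.2 hv).comp
    ((contMDiffOn_of_mem_maximalAtlas hφ).mono inter_subset_left) fun q hq => hq.2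

theorem mainTheorem3 {Q : Type*} [TopologicalSpace Q] [T2Space Q] [SecondCountableTopology Q]
    [ChartedSpace LCB.E2 Q] [IsManifold (𝓡 2) ∞ Q]
    (ρ : ContMDiffRiemannianMetric (𝓡 2) ∞ LCB.E2 (fun q : Q => TangentSpace (𝓡 2) q))
    (h : Q → ℝ) (hh : ContMDiff (𝓡 2) 𝓘(ℝ, ℝ) ∞ h)
    (ξ : ∀ q : Q, TangentSpace (𝓡 2) q →L[ℝ] ℝ) (hξ : LCB.IsSmoothForm ξ)
    (hξ0 : ∀ q : Q, ξ q ≠ 0)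
    (q₀ : Q) (hcrit : LCB.hamiltonianVF (LCB.simpleFn ρ.inner h) (LCB.nullPoint q₀) = 0)
    (φ : OpenPartialHomeomorph Q LCB.E2) (hφ : φ ∈ IsManifold.maximalAtlas (𝓡 2) ∞ Q)
    (hq₀ : q₀ ∈ φ.source) (hφ0 : φ q₀ = 0) (hφξ : LCB.IsAdapted ξ φ)
    (hpos : LCB.PositivityCondition ρ.inner h φ q₀) :
    ∃ (U : Set Q) (Y : ∀ α : LCB.CotangentBundle Q, TangentSpace LCB.cotModel α),
      IsOpen U ∧ q₀ ∈ U ∧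
      LCB.IsSmoothVFOn Y (LCB.cotangentOver U) ∧
      (∀ α ∈ LCB.cotangentOver U, Y α ∈ LCB.actuation ξ α) ∧
      LCB.IsStableAt LCB.cotModel
        (fun α => LCB.hamiltonianVF (LCB.simpleFn ρ.inner h) α + Y α)
        (LCB.cotangentOver U) (LCB.nullPoint q₀) ∧
      ∃ (g : ∀ q : Q, TangentSpace (𝓡 2) q →L[ℝ] TangentSpace (𝓡 2) q →L[ℝ] ℝ) (v : Q → ℝ),
        LCB.IsRiemannianMetricOn g U ∧ ContMDiffOn (𝓡 2) 𝓘(ℝ, ℝ) ∞ v U ∧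
        LCB.IsLyapunovOn LCB.cotModel
          (fun α => LCB.hamiltonianVF (LCB.simpleFn ρ.inner h) α + Y α)
          (LCB.simpleFn g v) (LCB.cotangentOver U) (LCB.nullPoint q₀) :=
  mainTheorem3_general φ hφ ρ.inner ⟨fun q _ => ρ.symm q, fun q _ => ρ.pos q,
    ρ.contMDiff.contMDiffOn⟩ h hh.contMDiffOn ξ hφξ q₀ hq₀ hφ0 hcrit hpos
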